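/- **Conventions.** Let $\mathbb F_4=\{0,1,\omega,\bar\omega\}$ with $\bar x=x^2$, and let $\langle u,v\rangle=\sum_i(u_i\bar v_i+\bar u_iv_i)$ on $\mathbb F_4^n$. An $[[n,k]]$ stabilizer code is given by an additive code $C\subseteq\mathbb F_4^n$ with $|C|=2^{n-k}$ and $C\subseteq C^\perp$ (dual with respect to $\langle\cdot,\cdot\rangle$). Its minimum distance is the least weight of a vector of $C^\perp\setminus C$, its rate is $k/n$, and its relative distance is (minimum distance)$/n$. Let $H_4(x)=-x\log_4\frac{x}{3}-(1-x)\log_4(1-x)$ with $H_4(0)=0$, and let $H_4^{-1}:[0,1]\to[0,3/4]$ be the inverse of its increasing branch. An $[[n,k]]$ code with relative distance $\delta$ meets the quantum Gilbert–Varshamov bound if $k/n\ge 1-2H_4(\delta)$. **Quantum Zyablov codes.** Let $n=2^m-1$ and $1\le k\le 2^{m-1}-1$, and let $C_{\rm RS}$ be the Reed–Solomon code over $\mathbb F_{2^m}$ of length $n$ and dimension $k$, with generator polynomial $\prod_{i=0}^{n-k-1}(x-\alpha^i)$, $\alpha$ a primitive element. Let $\mathcal B(C_{\rm RS})\subseteq\mathbb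 F_2^{nm}$ be its binary expansion with respect to a self-dual basis of $\mathbb F_{2^m}/\mathbb F_2$. The outer code, a quantum Reed–Solomon code, is given by $C_1=\omega\mathcal B(C_{\rm RS})+\bar\omega\mathcal B(C_{\rm RS})$. The inner code is an $[[n_2,m]]$ stabilizer code, with additive code $C_2$, that meets the quantum Gilbert–Varshamov bound. With an additive isomorphism $\rho:\mathbb F_4^m\to C_2^\perp/C_2$ preserving $\langle\cdot,\cdot\rangle$, the concatenated code is given by $\rho(C_1)=\{(\rho(v_1)+u_1,\dots,\rho(v_n)+u_n) : (v_1,\dots,v_n)\in C_1,\ v_i\in\mathbb F_4^m,\ u_i\in C_2\}$, where $\rho(v_i)$ also denotes a representative of the coset. **Theorem.** Let $0<R<1$. The maximum $$\delta^*=\max_{R<r<1}\tfrac12\left(1-\tfrac Rr\right)H_4^{-1}\!\left(\tfrac{1-r}{2}\right)$$ exists and is positive, and there is a sequence $(Q_i)_{i\in\mathbb N}$ of quantum Zyablov codes as above such that each outer code is an $[[nm,\,m(n-2k)]]$ stabilizer code, each $Q_i$ is an $[[nn_2,\,m(n-2k)]]$ stabilizer code (with $m,k,n,n_2$ depending on $i$),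 the lengths of the $Q_i$ tend to infinity, their rates tend to $R$, and their relative minimum distances $\delta_i$ satisfy $\liminf_{i\to\infty}\delta_i\ge\delta^*$. In particular the sequence is asymptotically good. -/

import Mathlib

open Filter Topology

noncomputable section

namespace QuantumCode

/-- The `q`-ary entropy function
`H_q(x) = -x log_q (x / (q - 1)) - (1 - x) log_q (1 - x)` (with `H_q(0) = 0`). -/
def qEntropy (q : ℕ) (x : ℝ) : ℝ :=
  -x * Real.logb q (x / (q - 1)) - (1 - x) * Real.logb q (1 - x)

/-- The inverse `H_4⁻¹ : [0, 1] → [0, 3/4]` of the increasing branch of `H_4`. -/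
def entropyInv4 : ℝ → ℝ :=
  Function.invFunOn (qEntropy 4) (Set.Icc 0 (3 / 4))

/-- The field with four elements. -/
abbrev F4 : Type := GaloisField 2 2

section AdditiveCodes

variable {ι : Type} [Fintype ι]

/-- The trace inner product `⟨u, v⟩ = ∑ᵢ (uᵢ v̄ᵢ + ūᵢ vᵢ)` on `F4 ^ ι`, where `x̄ = x²`. -/
def traceInner (u v : ι → F4) : F4 :=
  ∑ i, (u i * (v i) ^ 2 + (u i) ^ 2 * v i)

/-- The trace-dual `C^⊥` of an additive code `C` over `F4`. -/
def traceDual (C : AddSubgroup (ι → F4)) : AddSubgroup (ι → F4) where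
  carrier := {u | ∀ v ∈ C, traceInner u v = 0}
  zero_mem' := by
    intro v _
    simp [traceInner]
  add_mem' := by
    intro a b ha hb v hv
    have h : traceInner (a + b) v = traceInner a v + traceInner b v := by
      simp only [traceInner, Pi.add_apply, ← Finset.sum_add_distrib, CharTwo.add_sq]
      exact Finset.sum_congr rfl fun i _ => by ring
    rw [h, ha v hv, hb v hv, add_zero]
  neg_mem' := by
    intro a ha v hv
    have h : -a = a := by
      funext i
      exact CharTwo.neg_eq (a i)
    rw [h]
    exact ha v hv

/-- `C` is an `(n, 2^(n-k))` self-orthogonal additive code, `n` being the number of coordinates: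
the additive code `C ⊆ C^⊥` associated with an `[[n, k]]` stabilizer code. -/
def IsStabilizerCode (C : AddSubgroup (ι → F4)) (k : ℕ) : Prop :=
  C ≤ traceDual C ∧ Nat.card C * 2 ^ k = 2 ^ Fintype.card ι

open Classical in
/-- The minimum distance of the stabilizer code associated with `C`:
the least weight of a vector of `C^⊥ \ C` (this set is non-empty for every `[[n, k]]` code
with `k ≥ 1`). -/
def minDist (C : AddSubgroup (ι → F4)) : ℕ :=
  sInf {w | ∃ u ∈ traceDual C, u ∉ C ∧ hammingNorm u = w}

end AdditiveCodes

/-- The cyclic code of length `n` with generator polynomial `∏_{i=0}^{d-2} (x - α^i)`;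
the Reed--Solomon code of designed distance `d` when `α` is a primitive element and
`n = |K| - 1`. -/
def rsCode {K : Type} [Field K] (n : ℕ) (α : K) (d : ℕ) : Submodule K (Fin n → K) where
  carrier := {c | (∏ i ∈ Finset.range (d - 1), (Polynomial.X - Polynomial.C (α ^ i))) ∣
    ∑ j : Fin n, Polynomial.C (c j) * Polynomial.X ^ (j : ℕ)}
  zero_mem' := by simp
  add_mem' := by
    intro a b ha hb
    simp only [Set.mem_ofPred_eq, Pi.add_apply, map_add, add_mul, Finset.sum_add_distrib] at *
    exact dvd_add ha hb
  smul_mem' := by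
    intro s a ha
    simp only [Set.mem_ofPred_eq, Pi.smul_apply, smul_eq_mul, map_mul, mul_assoc,
      ← Finset.mul_sum] at *
    exact Dvd.dvd.mul_left ha _

/-- The binary expansion of a code `C` over `K` with respect to a basis `b` of `K` over `𝔽₂`. -/
def binaryExpansion {K : Type} [Field K] [Algebra (ZMod 2) K] {m n : ℕ}
    (b : Module.Basis (Fin m) (ZMod 2) K) (C : Submodule K (Fin n → K)) :
    AddSubgroup (Fin n × Fin m → ZMod 2) where
  carrier := {c | (fun i => ∑ j, c (i, j) • b j) ∈ C}
  zero_mem' := by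
    have h : (fun i : Fin n => ∑ j, (0 : Fin n × Fin m → ZMod 2) (i, j) • b j) = 0 := by
      funext i
      simp
    rw [Set.mem_ofPred_eq, h]
    exact C.zero_mem
  add_mem' := by
    intro x y hx hy
    have h : (fun i : Fin n => ∑ j, (x + y) (i, j) • b j) =
        (fun i => ∑ j, x (i, j) • b j) + fun i => ∑ j, y (i, j) • b j := by
      funext i
      simp [add_smul, Finset.sum_add_distrib]
    rw [Set.mem_ofPred_eq, h]
    exact C.add_mem hx hy
  neg_mem' := by
    intro x hx
    have h : (fun i : Fin n => ∑ j, (-x) (i, j) • b j) = -fun i => ∑ j, x (i, j) • b j := by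
      funext i
      simp only [Pi.neg_apply, neg_smul, Finset.sum_neg_distrib]
    rw [Set.mem_ofPred_eq, h]
    exact C.neg_mem hx

/-- The additive code `ω B + ω̄ B` over `F4` built from a binary code `B`, with `ω̄ = ω²`. -/
def omegaCode {ι : Type} (ω : F4) (B : AddSubgroup (ι → ZMod 2)) : AddSubgroup (ι → F4) where
  carrier := {u | ∃ x ∈ B, ∃ y ∈ B, u = fun p =>
    ω * algebraMap (ZMod 2) F4 (x p) + ω ^ 2 * algebraMap (ZMod 2) F4 (y p)}
  zero_mem' := ⟨0, B.zero_mem, 0, B.zero_mem, by funext p; simp⟩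
  add_mem' := by
    rintro _ _ ⟨x, hx, y, hy, rfl⟩ ⟨x', hx', y', hy', rfl⟩
    refine ⟨x + x', B.add_mem hx hx', y + y', B.add_mem hy hy', ?_⟩
    funext p
    simp only [Pi.add_apply, map_add]
    ring
  neg_mem' := by
    rintro _ ⟨x, hx, y, hy, rfl⟩
    refine ⟨-x, B.neg_mem hx, -y, B.neg_mem hy, ?_⟩
    funext p
    simp only [Pi.neg_apply, map_neg]
    ring

/-- The concatenation `ρ(C₁)`: all `(ρ(v₁) + u₁, …, ρ(vₙ) + uₙ)` with `(v₁, …, vₙ) ∈ C₁`,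
`vᵢ ∈ F4 ^ m`, and `uᵢ ∈ C₂`. The `i`-th block is thus an arbitrary representative in `C₂^⊥`
of the class `ρ(vᵢ) ∈ C₂^⊥ / C₂`. -/
def concatCode {n m n₂ : ℕ} (C₁ : AddSubgroup (Fin n × Fin m → F4))
    (C₂ : AddSubgroup (Fin n₂ → F4))
    (ρ : (Fin m → F4) ≃+ traceDual C₂ ⧸ C₂.addSubgroupOf (traceDual C₂)) :
    AddSubgroup (Fin n × Fin n₂ → F4) where
  carrier := {c | ∃ v ∈ C₁, ∃ u : Fin n → traceDual C₂,
    (∀ i, ρ (fun j => v (i, j)) = QuotientAddGroup.mk (u i)) ∧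
    ∀ i j, c (i, j) = (u i : Fin n₂ → F4) j}
  zero_mem' := by
    refine ⟨0, C₁.zero_mem, 0, fun i => ?_, fun i j => rfl⟩
    exact map_zero ρ
  add_mem' := by
    rintro c c' ⟨v, hv, u, hu, hc⟩ ⟨v', hv', u', hu', hc'⟩
    refine ⟨v + v', C₁.add_mem hv hv', u + u', fun i => ?_, fun i j => ?_⟩
    · have h : (fun j => (v + v') (i, j)) = (fun j => v (i, j)) + fun j => v' (i, j) := rfl
      rw [h, map_add, hu, hu']
      rfl
    · simp [hc, hc']
  neg_mem' := by
    rintro c ⟨v, hv, u, hu, hc⟩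
    refine ⟨-v, C₁.neg_mem hv, -u, fun i => ?_, fun i j => ?_⟩
    · have h : (fun j => (-v) (i, j)) = -fun j => v (i, j) := rfl
      rw [h, map_neg, hu]
      rfl
    · simp [hc]

/-- The data of a quantum Zyablov code. The outer code is the quantum Reed--Solomon code coming
from the Reed--Solomon code of length `2^m - 1` and dimension `k` over the field with `2^m`
elements; the inner code is an `[[n₂, m]]` stabilizer code that meets the quantum
Gilbert--Varshamov bound. -/
structure ZyablovCode where
  /-- The alphabet of the classical Reed--Solomon code has `2^m` elements. -/
  m : ℕ
  /-- The dimension of the Reed--Solomon code. -/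
  k : ℕ
  k_pos : 1 ≤ k
  k_le : k ≤ 2 ^ (m - 1) - 1
  /-- A primitive element of the field with `2^m` elements. -/
  α : GaloisField 2 m
  α_primitive : IsPrimitiveRoot α (2 ^ m - 1)
  /-- A self-dual basis. -/
  basis : Module.Basis (Fin m) (ZMod 2) (GaloisField 2 m)
  basis_selfDual : ∀ i j, Algebra.trace (ZMod 2) (GaloisField 2 m) (basis i * basis j) =
    if i = j then 1 else 0
  /-- A primitive element of `F4`. -/
  ω : F4
  ω_sq : ω ^ 2 = ω + 1
  /-- The length of the inner code. -/
  n₂ : ℕ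
  /-- The additive code associated with the inner code. -/
  C₂ : AddSubgroup (Fin n₂ → F4)
  inner_isStabilizerCode : IsStabilizerCode C₂ m
  inner_gv : (m : ℝ) / n₂ ≥ 1 - 2 * qEntropy 4 ((minDist C₂ : ℝ) / n₂)
  /-- An inner-product-preserving isomorphism `F4 ^ m ≃ C₂^⊥ / C₂`. -/
  ρ : (Fin m → F4) ≃+ traceDual C₂ ⧸ C₂.addSubgroupOf (traceDual C₂)
  ρ_inner : ∀ (a b : Fin m → F4) (u v : traceDual C₂),
    ρ a = QuotientAddGroup.mk u → ρ b = QuotientAddGroup.mk v →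
    traceInner (u : Fin n₂ → F4) (v : Fin n₂ → F4) = traceInner a b

namespace ZyablovCode

variable (Q : ZyablovCode)

/-- The length of the Reed--Solomon code. -/
def n : ℕ := 2 ^ Q.m - 1

/-- The classical `[n, k, n - k + 1]` Reed--Solomon code. -/
def classicalRS : Submodule (GaloisField 2 Q.m) (Fin Q.n → GaloisField 2 Q.m) :=
  rsCode Q.n Q.α (Q.n - Q.k + 1)

/-- The additive code associated with the outer quantum Reed--Solomon code. -/
def outer : AddSubgroup (Fin Q.n × Fin Q.m → F4) :=
  omegaCode Q.ω (binaryExpansion Q.basis Q.classicalRS)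

/-- The additive code associated with the concatenated quantum code. -/
def code : AddSubgroup (Fin Q.n × Fin Q.n₂ → F4) :=
  concatCode Q.outer Q.C₂ Q.ρ

/-- The number of physical qubits. -/
def length : ℕ := Q.n * Q.n₂

/-- The number of encoded qubits. -/
def dim : ℕ := Q.m * (Q.n - 2 * Q.k)

/-- The rate. -/
def rate : ℝ := (Q.dim : ℝ) / Q.length

/-- The relative minimum distance. -/
def relDist : ℝ := (minDist Q.code : ℝ) / Q.length

end ZyablovCode

end QuantumCode

end

/-! ### The field with four elements -/

namespace QuantumCode

/-! Concatenation multiplies distances. A word of the concatenated dual outside the code is read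
block by block through `ρ⁻¹` as a nonzero word of the dual of the outer code; each nonzero block of
that word comes from a vector of C₂^⊥ \ C₂. The outer dual has more than k nonzero blocks, so with k
= ⌊an⌋ and an inner code of rate at most r on the Gilbert–Varshamov bound the relative distance is
at least a·H₄⁻¹((1-r)/2) for every member of the sequence (`mul_minDist_le_hammingNorm`). The rate
(1-2k/n)(m/n₂) tends to (1-2a)r, which is R for a = (1-R/r)/2. Choosing r as the maximizer from
`exists_isGreatest` gives δ*.

Inner codes come from counting. Two transvections carry any nonzero vector to any other, so the
isometry group of the trace form is transitive on nonzero vectors, and under a random isometry the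
dual of a fixed [[n₂,m]] code is equidistributed there. A Hamming ball of the right radius has at
most 2^(n₂-m) words by the entropy estimate `card_ball_le`, so the dual of some isometric copy
misses its nonzero words (`exists_smul_notMem`, `exists_innerCode`). Starting from an explicit
standard code also supplies `ρ`.

For the outer code, a self-dual basis turns the binary inner product into the trace of the inner
product over the large field (`exists_selfDual_basis`, `sum_mul_eq_trace`). Duality is then that of
Reed–Solomon codes: self-orthogonal for 2k < n, with dual distance above k (`rsCode_orthogonal`,
`lt_hammingNorm_of_orthogonal`). -/

lemma F4.natCard : Nat.card F4 = 4 := by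
  have h := GaloisField.card 2 2 (by norm_num)
  simpa using h

noncomputable instance : Fintype F4 := Fintype.ofFinite _

lemma F4.card : Fintype.card F4 = 4 := by
  rw [← Nat.card_eq_fintype_card, F4.natCard]

lemma F4.pow_four (x : F4) : x ^ 4 = x := by
  have h := FiniteField.pow_card x
  rwa [F4.card] at h

lemma F4.two_eq_zero : (2 : F4) = 0 := CharTwo.two_eq_zero

lemma F4.exists_omega : ∃ ω : F4, ω ^ 2 = ω + 1 := by
  classical
  have h : ∃ x : F4, x ∉ ({0, 1} : Finset F4) := by
    by_contra! h
    have h1 : (Finset.univ : Finset F4) ⊆ {0, 1} := fun x _ => h x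
    have h2 := Finset.card_le_card h1
    rw [Finset.card_univ, F4.card] at h2
    have h3 : ({0, 1} : Finset F4).card ≤ 2 := Finset.card_le_two
    omega
  obtain ⟨x, hx⟩ := h
  simp only [Finset.mem_insert, Finset.mem_singleton, not_or] at hx
  refine ⟨x, ?_⟩
  have h4 := F4.pow_four x
  have h5 : x * (x - 1) * (x ^ 2 - (x + 1)) = 0 := by
    linear_combination h4 - (x ^ 3 - x ) * F4.two_eq_zero
  rcases mul_eq_zero.1 h5 with h | h
  · rcases mul_eq_zero.1 h with h | h
    · exact absurd h hx.1
    · exact absurd (sub_eq_zero.1 h) hx.2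
  · exact sub_eq_zero.1 h

/-! ### The trace form, its isometries and their transitivity -/

section Form
variable {ι : Type} [Fintype ι]

lemma traceInner_add_left (a b v : ι → F4) :
    traceInner (a + b) v = traceInner a v + traceInner b v := by
  simp only [traceInner, Pi.add_apply, ← Finset.sum_add_distrib, CharTwo.add_sq]
  exact Finset.sum_congr rfl fun i _ => by ring

lemma traceInner_comm (u v : ι → F4) : traceInner u v = traceInner v u :=
  Finset.sum_congr rfl fun i _ => by ring

lemma traceInner_add_right (v a b : ι → F4) :
    traceInner v (a + b) = traceInner v a + traceInner v b := by
  rw [traceInner_comm, traceInner_add_left, traceInner_comm a, traceInner_comm b]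

lemma traceInner_self (u : ι → F4) : traceInner u u = 0 := by
  refine Finset.sum_eq_zero fun i _ => ?_
  linear_combination (u i) ^ 3 * F4.two_eq_zero

@[simp] lemma traceInner_zero_left (u : ι → F4) : traceInner 0 u = 0 := by
  simp [traceInner]

@[simp] lemma traceInner_zero_right (u : ι → F4) : traceInner u 0 = 0 := by
  simp [traceInner]

lemma traceInner_sq (u v : ι → F4) : traceInner u v ^ 2 = traceInner u v := by
  rw [traceInner, CharTwo.sum_sq]
  refine Finset.sum_congr rfl fun i _ => ?_
  rw [CharTwo.add_sq]
  linear_combination u i ^ 2 * F4.pow_four (v i) + v i ^ 2 * F4.pow_four (u i)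

lemma traceInner_eq_zero_or_one (u v : ι → F4) :
    traceInner u v = 0 ∨ traceInner u v = 1 := by
  have h := traceInner_sq u v
  have h2 : traceInner u v * (traceInner u v - 1) = 0 := by linear_combination h
  rcases mul_eq_zero.1 h2 with h | h
  · exact Or.inl h
  · exact Or.inr (sub_eq_zero.1 h)

lemma exists_traceInner_eq_one {u : ι → F4} (hu : u ≠ 0) : ∃ v, traceInner u v = 1 := by
  classical
  obtain ⟨i, hi⟩ := Function.ne_iff.1 hu
  have hi' : u i ≠ 0 := hi
  obtain ⟨ω, hω⟩ := F4.exists_omega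
  -- Since (ω/uᵢ)⁴ = ω/uᵢ, the two summands at i are ω and ω², whose sum is 1.
  refine ⟨Pi.single i ((ω / u i) ^ 2), ?_⟩
  rw [traceInner, Finset.sum_eq_single i]
  · rw [Pi.single_eq_same]
    have h := F4.pow_four (ω / u i)
    have h1 : u i * (ω / u i) = ω := by field_simp
    have h2 : u i ^ 2 * (ω / u i) ^ 2 = ω ^ 2 := by field_simp
    linear_combination u i * h + h1 + h2 + hω + ω * F4.two_eq_zero
  · intro j _ hj
    simp [Pi.single_eq_of_ne hj]
  · simp

/-- If witnesses for u and for v each fail for the other vector, their sum works for both. Such a w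
is the halfway point from u to v in `exists_isometry_smul_eq`. -/
lemma exists_traceInner_eq_one₂ {u v : ι → F4} (hu : u ≠ 0) (hv : v ≠ 0) :
    ∃ w, traceInner u w = 1 ∧ traceInner v w = 1 := by
  obtain ⟨a, ha⟩ := exists_traceInner_eq_one hu
  obtain ⟨b, hb⟩ := exists_traceInner_eq_one hv
  rcases traceInner_eq_zero_or_one v a with h | h
  · rcases traceInner_eq_zero_or_one u b with h' | h'
    · exact ⟨a + b, by simp [traceInner_add_right, ha, h'], by simp [traceInner_add_right, hb, h]⟩
    · exact ⟨b, h', hb⟩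
  · exact ⟨a, ha, h⟩

/-- The form is only 𝔽₂-bilinear, so the scalar has to lie in {0, 1}; values of the form itself
qualify by `traceInner_sq`. -/
lemma traceInner_smul_left {c : F4} (hc : c ^ 2 = c) (u v : ι → F4) :
    traceInner (c • u) v = c * traceInner u v := by
  rw [traceInner, traceInner, Finset.mul_sum]
  refine Finset.sum_congr rfl fun i _ => ?_
  simp only [Pi.smul_apply, smul_eq_mul]
  linear_combination u i ^ 2 * v i * hc

lemma traceInner_smul_right {c : F4} (hc : c ^ 2 = c) (u v : ι → F4) :
    traceInner u (c • v) = c * traceInner u v := by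
  rw [traceInner_comm, traceInner_smul_left hc, traceInner_comm]

lemma pi_add_self {κ : Type} (u : κ → F4) : u + u = 0 := funext fun i => CharTwo.add_self_eq_zero (u i)

lemma mem_traceDual {C : AddSubgroup (ι → F4)} {u : ι → F4} :
    u ∈ traceDual C ↔ ∀ v ∈ C, traceInner u v = 0 := Iff.rfl

/-- The group of additive automorphisms of `F4 ^ ι` that preserve the trace inner product. -/
def isometryGroup (ι : Type) [Fintype ι] : Subgroup (Equiv.Perm (ι → F4)) where
  carrier := {g | (∀ x y, g (x + y) = g x + g y) ∧
    ∀ x y, traceInner (g x) (g y) = traceInner x y}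
  one_mem' := ⟨fun _ _ => rfl, fun _ _ => rfl⟩
  mul_mem' := by
    intro g h hg hh
    exact ⟨fun x y => by simp only [Equiv.Perm.mul_apply, hh.1, hg.1],
      fun x y => by simp only [Equiv.Perm.mul_apply, hh.2, hg.2]⟩
  inv_mem' := by
    intro g hg
    refine ⟨fun x y => ?_, fun x y => ?_⟩
    · rw [Equiv.Perm.inv_eq_iff_eq, hg.1]
      simp
    · rw [← hg.2]
      simp

/-- The additive automorphism underlying an isometry. -/
def isometryGroup.toAddEquiv (g : isometryGroup ι) : (ι → F4) ≃+ (ι → F4) :=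
  { (g : Equiv.Perm (ι → F4)) with map_add' := g.2.1 }

lemma isometryGroup.toAddEquiv_apply (g : isometryGroup ι) (x : ι → F4) :
    isometryGroup.toAddEquiv g x = g • x := rfl

lemma isometryGroup.traceInner_smul (g : isometryGroup ι) (x y : ι → F4) :
    traceInner (g • x) (g • y) = traceInner x y := g.2.2 x y

/-- The transvection `x ↦ x + ⟨x, w⟩ w`. -/
noncomputable def transvection (w : ι → F4) : Equiv.Perm (ι → F4) :=
  have h : ∀ x, (x + traceInner x w • w) + traceInner (x + traceInner x w • w) w • w = x := by
    intro x
    rw [traceInner_add_left, traceInner_smul_left (traceInner_sq x w), traceInner_self, mul_zero,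
      add_zero, add_assoc, pi_add_self, add_zero]
  { toFun := fun x => x + traceInner x w • w
    invFun := fun x => x + traceInner x w • w
    left_inv := h
    right_inv := h }

lemma transvection_apply (w x : ι → F4) : transvection w x = x + traceInner x w • w := rfl

lemma transvection_mem (w : ι → F4) : transvection w ∈ isometryGroup ι := by
  refine ⟨fun x y => ?_, fun x y => ?_⟩
  · simp only [transvection_apply, traceInner_add_left, add_smul]
    abel
  · rw [transvection_apply, transvection_apply, traceInner_add_left, traceInner_add_right,
      traceInner_add_right, traceInner_smul_left (traceInner_sq x w),
      traceInner_smul_right (traceInner_sq y w), traceInner_smul_left (traceInner_sq x w),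
      traceInner_smul_right (traceInner_sq y w), traceInner_self, traceInner_comm w y]
    linear_combination traceInner x w * traceInner y w * F4.two_eq_zero

lemma transvection_add {u v : ι → F4} (h : traceInner u v = 1) : transvection (u + v) u = v := by
  rw [transvection_apply, traceInner_add_right, traceInner_self, h, zero_add, one_smul,
    ← add_assoc, pi_add_self, zero_add]

lemma exists_isometry_smul_eq {u v : ι → F4} (hu : u ≠ 0) (hv : v ≠ 0) :
    ∃ g : isometryGroup ι, g • u = v := by
  obtain ⟨w, h1, h2⟩ := exists_traceInner_eq_one₂ hu hv
  refine ⟨⟨transvection (w + v) * transvection (u + w),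
    mul_mem (transvection_mem _) (transvection_mem _)⟩, ?_⟩
  change (transvection (w + v) * transvection (u + w)) u = v
  rw [Equiv.Perm.mul_apply, transvection_add h1, transvection_add (by rw [traceInner_comm, h2])]

end Form

/-- If a finite group acts transitively on a finite set `A`, and `S`, `T` are subsets of `A` with
`|S| * |T| < |A|`, then some translate of `S` misses `T`. -/
lemma exists_smul_notMem {G X : Type*} [Group G] [Finite G] [MulAction G X] {A S T : Finset X}
    (hA : ∀ (g : G), ∀ x ∈ A, g • x ∈ A) (htrans : ∀ x ∈ A, ∀ y ∈ A, ∃ g : G, g • x = y)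
    (hS : S ⊆ A) (hT : T ⊆ A) (hcard : S.card * T.card < A.card) :
    ∃ g : G, ∀ s ∈ S, g • s ∉ T := by
  classical
  have := Fintype.ofFinite G
  by_contra! hcon
  -- The elements carrying s to t. By transitivity all these sets have the same size |G|/|A|.
  let H : X → X → Finset G := fun s t => Finset.univ.filter fun g => g • s = t
  have hH : ∀ s ∈ A, ∀ t ∈ A, (H s t).card * A.card = Fintype.card G := by
    intro s hs t ht
    have h1 : ∀ t' ∈ A, (H s t').card = (H s t).card := by
      intro t' ht'
      obtain ⟨g, hg⟩ := htrans t' ht' t ht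
      refine Finset.card_bij (fun h _ => g * h) ?_ ?_ ?_
      · intro h hh
        simp only [H, Finset.mem_filter, Finset.mem_univ, true_and] at hh ⊢
        rw [mul_smul, hh, hg]
      · intro a _ b _ hab
        exact mul_left_cancel hab
      · intro h hh
        simp only [H, Finset.mem_filter, Finset.mem_univ, true_and] at hh ⊢
        exact ⟨g⁻¹ * h, by rw [mul_smul, hh, ← hg, inv_smul_smul], by simp⟩
    have h2 : (Finset.univ : Finset G).card = ∑ t' ∈ A, (H s t').card :=
      Finset.card_eq_sum_card_fiberwise fun g _ => hA g s hs
    rw [Finset.sum_congr rfl h1, Finset.sum_const, smul_eq_mul, Finset.card_univ] at h2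
    rw [h2, mul_comm]
  -- If every translate of S met T, the |S||T| sets `H s t` would cover G, forcing |A| ≤ |S||T|.
  have hcover : (Finset.univ : Finset G) ⊆ (S ×ˢ T).biUnion fun p => H p.1 p.2 := by
    intro g _
    obtain ⟨s, hs, hg⟩ := hcon g
    refine Finset.mem_biUnion.2 ⟨(s, g • s), Finset.mem_product.2 ⟨hs, hg⟩, ?_⟩
    simp [H]
  have h1 : Fintype.card G * A.card ≤ S.card * T.card * Fintype.card G := by
    calc Fintype.card G * A.card
        ≤ (∑ p ∈ S ×ˢ T, (H p.1 p.2).card) * A.card :=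
          Nat.mul_le_mul_right _ ((Finset.card_le_card hcover).trans Finset.card_biUnion_le)
      _ = ∑ p ∈ S ×ˢ T, Fintype.card G := by
          rw [Finset.sum_mul]
          refine Finset.sum_congr rfl fun p hp => ?_
          rw [Finset.mem_product] at hp
          exact hH _ (hS hp.1) _ (hT hp.2)
      _ = S.card * T.card * Fintype.card G := by
          rw [Finset.sum_const, Finset.card_product, smul_eq_mul]
  have h2 : 0 < Fintype.card G := Fintype.card_pos
  nlinarith

/-! ### Stabilizer codes whose dual avoids a prescribed set -/

section InnerCode

/-- An isometric splitting `φ` of `C^⊥` modulo `C` yields an isometry onto `C^⊥ / C`. -/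
lemma exists_isometry_quotient {ι κ : Type} [Fintype ι] [Fintype κ] {C : AddSubgroup (ι → F4)}
    (φ : (κ → F4) →+ (ι → F4)) (hφ : ∀ a, φ a ∈ traceDual C)
    (hiso : ∀ a b, traceInner (φ a) (φ b) = traceInner a b)
    (hsurj : ∀ u ∈ traceDual C, ∃ a, φ a + u ∈ C) :
    ∃ ρ : (κ → F4) ≃+ traceDual C ⧸ C.addSubgroupOf (traceDual C),
      ∀ (a b : κ → F4) (u v : traceDual C),
        ρ a = QuotientAddGroup.mk u → ρ b = QuotientAddGroup.mk v →
        traceInner (u : ι → F4) (v : ι → F4) = traceInner a b := by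
  let ψ : (κ → F4) →+ traceDual C := φ.codRestrict (traceDual C) hφ
  let π : (κ → F4) →+ traceDual C ⧸ C.addSubgroupOf (traceDual C) :=
    (QuotientAddGroup.mk' _).comp ψ
  have key : ∀ a (u : traceDual C), π a = QuotientAddGroup.mk u ↔ φ a + u ∈ C := by
    intro a u
    change (QuotientAddGroup.mk (ψ a) : traceDual C ⧸ C.addSubgroupOf (traceDual C)) = _ ↔ _
    rw [QuotientAddGroup.eq, AddSubgroup.mem_addSubgroupOf]
    have h : ((-ψ a + u : traceDual C) : ι → F4) = φ a + u := by
      have h1 : -φ a = φ a := neg_eq_of_add_eq_zero_left (pi_add_self _)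
      change -φ a + u = _
      rw [h1]
    rw [h]
  -- If φ a lies in C, it is orthogonal to every φ b in C^⊥, so a is orthogonal to everything.
  have hinj : Function.Injective π := by
    rw [injective_iff_map_eq_zero]
    intro a ha
    have h := (key a 0).1 ha
    rw [AddSubgroup.coe_zero, add_zero] at h
    by_contra hne
    obtain ⟨b, hb⟩ := exists_traceInner_eq_one hne
    rw [← hiso, traceInner_comm, mem_traceDual.1 (hφ b) _ h] at hb
    exact zero_ne_one hb
  have hsur : Function.Surjective π := by
    intro q
    obtain ⟨u, rfl⟩ := QuotientAddGroup.mk_surjective q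
    obtain ⟨a, ha⟩ := hsurj u u.2
    exact ⟨a, (key a u).2 ha⟩
  refine ⟨AddEquiv.ofBijective π ⟨hinj, hsur⟩, fun a b u v hu hv => ?_⟩
  have h1 := (key a u).1 hu
  have h2 := (key b v).1 hv
  -- Pairing φ b with φ a + u, and u with φ b + v, gives ⟨a,b⟩ = ⟨u,φ b⟩ = ⟨u,v⟩.
  have h3 := mem_traceDual.1 (hφ b) _ h1
  have h4 := mem_traceDual.1 u.2 _ h2
  rw [traceInner_add_right, traceInner_comm _ (φ a), hiso] at h3
  rw [traceInner_add_right] at h4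
  rw [traceInner_comm _ (u : ι → F4)] at h3
  have h5 : traceInner (u : ι → F4) (φ b) + traceInner (u : ι → F4) (φ b) = 0 :=
    CharTwo.add_self_eq_zero _
  linear_combination h4 - h3

variable {κ ν : Type} [Fintype κ] [Fintype ν]

/-- The code of all vectors which vanish on `κ` and have entries in `{0, 1}` on `ν`. -/
def standardCode (κ ν : Type) : AddSubgroup (κ ⊕ ν → F4) where
  carrier := {v | (∀ i, v (Sum.inl i) = 0) ∧ ∀ j, v (Sum.inr j) ^ 2 = v (Sum.inr j)}
  zero_mem' := by simp
  add_mem' := by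
    rintro a b ⟨ha, ha'⟩ ⟨hb, hb'⟩
    exact ⟨fun i => by simp [ha, hb], fun j => by simp [CharTwo.add_sq, ha', hb']⟩
  neg_mem' := by
    rintro a ⟨ha, ha'⟩
    exact ⟨fun i => by simp [ha], fun j => by
      rw [Pi.neg_apply, CharTwo.neg_eq, ha']⟩

lemma traceInner_sum (u v : κ ⊕ ν → F4) :
    traceInner u v = traceInner (fun i => u (Sum.inl i)) (fun i => v (Sum.inl i)) +
      traceInner (fun i => u (Sum.inr i)) (fun i => v (Sum.inr i)) := by
  simp only [traceInner, Fintype.sum_sum_type]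

/-- Pairing with the unit vector at j gives uⱼ² + uⱼ, which vanishes only on {0, 1}. The coordinates
in κ are free, so modulo the code the dual is F4^κ. -/
lemma mem_traceDual_standardCode {u : κ ⊕ ν → F4} :
    u ∈ traceDual (standardCode κ ν) ↔ ∀ j, u (Sum.inr j) ^ 2 = u (Sum.inr j) := by
  classical
  constructor
  · intro h j
    have h1 := h (Pi.single (Sum.inr j) 1) ⟨fun i => by simp, fun j' => by
      by_cases hj : j' = j
      · subst hj; simp
      · rw [Pi.single_eq_of_ne (by simpa using hj)]; simp⟩
    rw [traceInner, Finset.sum_eq_single (Sum.inr j)] at h1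
    · simp only [Pi.single_eq_same, one_pow, mul_one] at h1
      linear_combination h1 - u (Sum.inr j) * F4.two_eq_zero
    · intro b _ hb
      simp [Pi.single_eq_of_ne hb]
    · simp
  · rintro h v ⟨hv, hv'⟩
    refine Finset.sum_eq_zero fun i _ => ?_
    rcases i with i | j
    · simp [hv]
    · rw [h, hv']
      exact CharTwo.add_self_eq_zero _

/-- The elements of `{0, 1} ⊆ F4`. -/
noncomputable def idempotentEquiv : {x : F4 // x ^ 2 = x} ≃ Fin 2 where
  toFun x := by classical exact if x.1 = 0 then 0 else 1
  invFun i := ⟨if i = 0 then 0 else 1, by split_ifs <;> simp⟩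
  left_inv := by
    rintro ⟨x, hx⟩
    by_cases h : x = 0
    · simp [h]
    · have h1 : x = 1 := by
        have : x * x = x * 1 := by linear_combination hx
        exact mul_left_cancel₀ h this
      simp [h1]
  right_inv := by
    intro i
    fin_cases i <;> simp

omit [Fintype κ] in
lemma natCard_standardCode : Nat.card (standardCode κ ν) = 2 ^ Fintype.card ν := by
  let e : standardCode κ ν ≃ (ν → {x : F4 // x ^ 2 = x}) :=
    { toFun := fun v j => ⟨v.1 (Sum.inr j), v.2.2 j⟩
      invFun := fun w => ⟨Sum.elim 0 fun j => (w j).1, fun i => rfl, fun j => (w j).2⟩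
      left_inv := by
        rintro ⟨v, hv, hv'⟩
        ext i
        rcases i with i | j
        · exact (hv i).symm
        · rfl
      right_inv := fun w => rfl }
  rw [Nat.card_congr (e.trans (Equiv.arrowCongr (Equiv.refl ν) idempotentEquiv)),
    Nat.card_fun, Nat.card_eq_fintype_card, Nat.card_eq_fintype_card, Fintype.card_fin]

lemma natCard_traceDual_standardCode :
    Nat.card (traceDual (standardCode κ ν)) = 4 ^ Fintype.card κ * 2 ^ Fintype.card ν := by
  let e : traceDual (standardCode κ ν) ≃ (κ → F4) × (ν → {x : F4 // x ^ 2 = x}) :=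
    { toFun := fun v => (fun i => v.1 (Sum.inl i),
        fun j => ⟨v.1 (Sum.inr j), mem_traceDual_standardCode.1 v.2 j⟩)
      invFun := fun w => ⟨Sum.elim w.1 fun j => (w.2 j).1,
        mem_traceDual_standardCode.2 fun j => (w.2 j).2⟩
      left_inv := by
        rintro ⟨v, hv⟩
        ext i
        rcases i with i | j <;> rfl
      right_inv := fun w => rfl }
  rw [Nat.card_congr (e.trans (Equiv.prodCongr (Equiv.refl _)
    (Equiv.arrowCongr (Equiv.refl ν) idempotentEquiv))),
    Nat.card_prod, Nat.card_fun, Nat.card_fun, F4.natCard]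
  simp only [Nat.card_eq_fintype_card, Fintype.card_fin]

/-- The inclusion of `F4 ^ κ` into `F4 ^ (κ ⊕ ν)`. -/
noncomputable def inlHom (κ ν : Type) : (κ → F4) →+ (κ ⊕ ν → F4) where
  toFun a := Sum.elim a 0
  map_zero' := by ext i; rcases i with i | i <;> rfl
  map_add' a b := by
    ext i
    rcases i with i | i
    · rfl
    · simp

lemma traceDual_map_smul {ι : Type} [Fintype ι] (g : isometryGroup ι)
    (C : AddSubgroup (ι → F4)) {u : ι → F4} :
    g • u ∈ traceDual (C.map (isometryGroup.toAddEquiv g).toAddMonoidHom) ↔ u ∈ traceDual C := by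
  constructor
  · intro h v hv
    rw [← isometryGroup.traceInner_smul g]
    exact h _ ⟨v, hv, rfl⟩
  · rintro h _ ⟨v, hv, rfl⟩
    exact (isometryGroup.traceInner_smul g u v).trans (h v hv)

open Classical in
/-- A Gilbert--Varshamov argument for stabilizer codes. -/
lemma exists_stabilizerCode_sum [Nonempty κ] (T : Finset (κ ⊕ ν → F4)) (h0 : 0 ∉ T)
    (hT : T.card < 2 ^ Fintype.card ν) :
    ∃ C : AddSubgroup (κ ⊕ ν → F4), IsStabilizerCode C (Fintype.card κ) ∧
      (∀ u ∈ traceDual C, u ≠ 0 → u ∉ T) ∧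
      ∃ φ : (κ → F4) →+ (κ ⊕ ν → F4), (∀ a, φ a ∈ traceDual C) ∧
        (∀ a b, traceInner (φ a) (φ b) = traceInner a b) ∧
        ∀ u ∈ traceDual C, ∃ a, φ a + u ∈ C := by
  let D := standardCode κ ν
  let A : Finset (κ ⊕ ν → F4) := Finset.univ.erase 0
  let S : Finset (κ ⊕ ν → F4) := (Finset.univ.filter fun u => u ∈ traceDual D).erase 0
  have hScard : S.card + 1 = 4 ^ Fintype.card κ * 2 ^ Fintype.card ν := by
    rw [Finset.card_erase_add_one (by simp [zero_mem]), ← natCard_traceDual_standardCode,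
      Nat.card_eq_fintype_card]
    exact (Fintype.card_subtype _).symm
  have hAcard : A.card + 1 = 4 ^ Fintype.card κ * 4 ^ Fintype.card ν := by
    rw [Finset.card_erase_add_one (Finset.mem_univ _), Finset.card_univ, Fintype.card_fun, F4.card,
      Fintype.card_sum, pow_add]
  -- With x = 4^|κ| and y = 2^|ν| the worst case |T| = y - 1 reads (xy-1)(y-1) < xy² - 1, that is,
  -- xy + y > 2.
  have hlt : S.card * T.card < A.card := by
    have h1 : (4 : ℕ) ^ Fintype.card ν = 2 ^ Fintype.card ν * 2 ^ Fintype.card ν := by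
      rw [← mul_pow]; norm_num
    have h2 : 4 ≤ 4 ^ Fintype.card κ := by
      calc 4 = 4 ^ 1 := rfl
        _ ≤ 4 ^ Fintype.card κ := Nat.pow_le_pow_right (by norm_num) Fintype.card_pos
    have h3 : 1 ≤ 2 ^ Fintype.card ν := Nat.one_le_two_pow
    rw [h1] at hAcard
    generalize 4 ^ Fintype.card κ = x at *
    generalize 2 ^ Fintype.card ν = y at *
    have h4 : T.card + 1 ≤ y := hT
    nlinarith [Nat.mul_le_mul_left (S.card) h4, Nat.mul_le_mul_right y hScard.le]
  obtain ⟨g, hg⟩ := exists_smul_notMem (G := isometryGroup (κ ⊕ ν)) (A := A) (S := S) (T := T)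
    (by
      intro g x hx
      have hx' : x ≠ 0 := by simpa [A] using hx
      have : g • x ≠ 0 := by
        rw [← isometryGroup.toAddEquiv_apply]
        exact (AddEquivClass.map_ne_zero_iff).2 hx'
      simpa [A] using this)
    (by
      intro x hx y hy
      exact exists_isometry_smul_eq (by simpa [A] using hx) (by simpa [A] using hy))
    (Finset.erase_subset_erase _ (Finset.subset_univ _))
    (by
      intro x hx
      have : x ≠ 0 := fun h => h0 (h ▸ hx)
      simpa [A] using this) hlt
  -- The code sought is the image of the standard code under g; its dual is the image of the
  -- standard dual, whose nonzero vectors g moves off T.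
  let f := isometryGroup.toAddEquiv g
  have hdual : ∀ u, u ∈ traceDual (D.map f.toAddMonoidHom) → ∃ u' ∈ traceDual D, g • u' = u := by
    intro u hu
    obtain ⟨u', rfl⟩ := f.surjective u
    exact ⟨u', (traceDual_map_smul g D).1 hu, rfl⟩
  have hself : D.map f.toAddMonoidHom ≤ traceDual (D.map f.toAddMonoidHom) := by
    rintro _ ⟨u, hu, rfl⟩
    exact (traceDual_map_smul g D).2 (mem_traceDual_standardCode.2 hu.2)
  refine ⟨D.map f.toAddMonoidHom, ⟨hself, ?_⟩, ?_, ?_⟩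
  · rw [Nat.card_congr (D.equivMapOfInjective f.toAddMonoidHom f.injective).symm.toEquiv,
      natCard_standardCode, Fintype.card_sum, pow_add, mul_comm]
  · intro u hu hne
    obtain ⟨u', hu', rfl⟩ := hdual u hu
    refine hg u' (Finset.mem_erase.2 ⟨?_, by simpa using hu'⟩)
    rintro rfl
    exact hne (map_zero f)
  · refine ⟨f.toAddMonoidHom.comp (inlHom κ ν), ?_, ?_, ?_⟩
    · intro a
      refine (traceDual_map_smul g D).2 (mem_traceDual_standardCode.2 fun j => ?_)
      simp [inlHom]
    · intro a b
      refine (isometryGroup.traceInner_smul g _ _).trans ?_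
      rw [traceInner_sum]
      have h : (fun i : ν => (inlHom κ ν) a (Sum.inr i)) = 0 := rfl
      rw [h, traceInner_zero_left, add_zero]
      rfl
    · intro u hu
      obtain ⟨u', hu', rfl⟩ := hdual u hu
      refine ⟨fun i => u' (Sum.inl i), inlHom κ ν (fun i => u' (Sum.inl i)) + u', ⟨fun i => ?_,
        fun j => ?_⟩, map_add f _ _⟩
      · exact CharTwo.add_self_eq_zero (u' (Sum.inl i))
      · have := mem_traceDual_standardCode.1 hu' j
        simpa [inlHom] using this

lemma traceInner_comp_equiv {ι ι' : Type} [Fintype ι] [Fintype ι'] (e : ι' ≃ ι) (u v : ι → F4) :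
    traceInner (u ∘ e) (v ∘ e) = traceInner u v :=
  e.sum_comp fun i => u i * v i ^ 2 + u i ^ 2 * v i

/-- A Gilbert--Varshamov argument: if `T` is a set of less than `2 ^ (n - m)` nonzero vectors, then
there is an `[[n, m]]` stabilizer code whose dual avoids `T`. -/
lemma exists_stabilizerCode {m l n : ℕ} (hn : m + l = n) (hm : 1 ≤ m) (T : Finset (Fin n → F4))
    (h0 : 0 ∉ T) (hT : T.card < 2 ^ l) :
    ∃ C : AddSubgroup (Fin n → F4), IsStabilizerCode C m ∧
      (∀ u ∈ traceDual C, u ≠ 0 → u ∉ T) ∧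
      ∃ ρ : (Fin m → F4) ≃+ traceDual C ⧸ C.addSubgroupOf (traceDual C),
        ∀ (a b : Fin m → F4) (u v : traceDual C),
          ρ a = QuotientAddGroup.mk u → ρ b = QuotientAddGroup.mk v →
          traceInner (u : Fin n → F4) (v : Fin n → F4) = traceInner a b := by
  classical
  let e : Fin m ⊕ Fin l ≃ Fin n := finSumFinEquiv.trans (finCongr hn)
  let r : (Fin n → F4) ≃+ (Fin m ⊕ Fin l → F4) :=
    { Equiv.arrowCongr e.symm (Equiv.refl F4) with map_add' := fun _ _ => rfl }
  have hr : ∀ u v, traceInner (r u) (r v) = traceInner u v := traceInner_comp_equiv e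
  have : Nonempty (Fin m) := ⟨⟨0, hm⟩⟩
  obtain ⟨C, ⟨hC, hcard⟩, hCT, φ, hφ, hiso, hsurj⟩ :=
    exists_stabilizerCode_sum (κ := Fin m) (ν := Fin l) (T.map r.toEquiv.toEmbedding)
      (by
        rw [Finset.mem_map]
        rintro ⟨x, hx, hx'⟩
        have : x = 0 := r.map_eq_zero_iff.1 hx'
        exact h0 (this ▸ hx))
      (by rwa [Finset.card_map, Fintype.card_fin])
  have hdual : ∀ u, u ∈ traceDual (C.comap r.toAddMonoidHom) ↔ r u ∈ traceDual C := by
    intro u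
    constructor
    · intro h v hv
      obtain ⟨v, rfl⟩ := r.surjective v
      rw [hr]
      exact h v hv
    · intro h v hv
      rw [← hr]
      exact h _ hv
  refine ⟨C.comap r.toAddMonoidHom, ⟨fun u hu => (hdual u).2 (hC hu), ?_⟩, ?_, ?_⟩
  · have h1 : Nat.card (C.comap r.toAddMonoidHom) = Nat.card C :=
      Nat.card_congr (r.toEquiv.subtypeEquiv fun _ => Iff.rfl)
    rw [h1]
    rw [Fintype.card_fin] at hcard
    rw [hcard, Fintype.card_sum, Fintype.card_fin, Fintype.card_fin, Fintype.card_fin, hn]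
  · intro u hu hne huT
    exact hCT (r u) ((hdual u).1 hu) (fun h => hne (r.map_eq_zero_iff.1 h))
      (Finset.mem_map_of_mem _ huT)
  · refine exists_isometry_quotient (r.symm.toAddMonoidHom.comp φ) ?_ ?_ ?_
    · intro a
      rw [hdual]
      change r (r.symm (φ a)) ∈ _
      rw [r.apply_symm_apply]
      exact hφ a
    · intro a b
      rw [← hr]
      change traceInner (r (r.symm (φ a))) (r (r.symm (φ b))) = _
      rw [r.apply_symm_apply, r.apply_symm_apply, hiso]
    · intro u hu
      obtain ⟨a, ha⟩ := hsurj _ ((hdual u).1 hu)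
      refine ⟨a, ?_⟩
      change r (r.symm (φ a) + u) ∈ C
      rwa [map_add, r.apply_symm_apply]

end InnerCode

end QuantumCode
namespace QuantumCode

/-! ### Self-dual bases over 𝔽₂ -/

section SelfDualBasis

variable {V : Type*} [AddCommGroup V] [Module (ZMod 2) V]

/-- An orthonormal family for a bilinear form over `𝔽₂`. -/
def IsOrthonormalFamily (B : LinearMap.BilinForm (ZMod 2) V) {l : ℕ} (f : Fin l → V) : Prop :=
  ∀ i j, B (f i) (f j) = if i = j then 1 else 0

variable {B : LinearMap.BilinForm (ZMod 2) V}

lemma IsOrthonormalFamily.cons (hsymm : ∀ x y, B x y = B y x) {l : ℕ} {f : Fin l → V}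
    (hf : IsOrthonormalFamily B f) {a : V} (ha : B a a = 1) (haf : ∀ i, B a (f i) = 0) :
    IsOrthonormalFamily B (Fin.cons a f : Fin (l + 1) → V) := by
  intro i j
  refine Fin.cases ?_ (fun i => ?_) i <;> refine Fin.cases ?_ (fun j => ?_) j
  · simpa using ha
  · simpa [(Fin.succ_ne_zero j).symm] using haf j
  · simpa [Fin.succ_ne_zero i, hsymm (f i) a] using haf i
  · simpa using hf i j

lemma IsOrthonormalFamily.linearIndependent {l : ℕ} {f : Fin l → V}
    (hf : IsOrthonormalFamily B f) : LinearIndependent (ZMod 2) f := by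
  rw [Fintype.linearIndependent_iff]
  intro g hg i
  have h : B (∑ j, g j • f j) (f i) = g i := by
    simp [hf _ i]
  rw [← h, hg]
  simp

/-- The component of `x` orthogonal to the family `f`. -/
def orthogonalPart (B : LinearMap.BilinForm (ZMod 2) V) {l : ℕ} (f : Fin l → V) (x : V) : V :=
  x - ∑ j, B x (f j) • f j

lemma IsOrthonormalFamily.apply_orthogonalPart {l : ℕ}
    {f : Fin l → V} (hf : IsOrthonormalFamily B f) (x : V) (i : Fin l) :
    B (orthogonalPart B f x) (f i) = 0 := by
  simp [orthogonalPart, hf _ i]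

lemma ZMod.eq_zero_or_one_of_two (a : ZMod 2) : a = 0 ∨ a = 1 := by
  revert a; decide

/-- Take a, b orthogonal to the family with B a b = 1. If one of them has norm 1, it is adjoined.
Otherwise they span a hyperbolic plane, and together with one member v of the family they yield the
orthonormal triple v+a, v+b, v+a+b, which replaces v. This exchange is why the family must be
nonempty. -/
lemma IsOrthonormalFamily.exists_larger (hsymm : ∀ x y, B x y = B y x)
    (hnd : ∀ x, x ≠ 0 → ∃ y, B x y = 1) {l : ℕ} {f : Fin (l + 1) → V}
    (hf : IsOrthonormalFamily B f) {x : V} (hx : orthogonalPart B f x ≠ 0) :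
    ∃ l' > l + 1, ∃ f' : Fin l' → V, IsOrthonormalFamily B f' := by
  set a := orthogonalPart B f x with ha
  have haf : ∀ i, B a (f i) = 0 := hf.apply_orthogonalPart x
  obtain ⟨y, hy⟩ := hnd a hx
  set b := orthogonalPart B f y with hb
  have hbf : ∀ i, B b (f i) = 0 := hf.apply_orthogonalPart y
  have hab : B a b = 1 := by
    rw [hb, orthogonalPart]
    simp [haf, hy]
  rcases ZMod.eq_zero_or_one_of_two (B a a) with haa | haa
  swap
  · exact ⟨l + 2, by omega, _, hf.cons hsymm haa haf⟩
  rcases ZMod.eq_zero_or_one_of_two (B b b) with hbb | hbb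
  swap
  · exact ⟨l + 2, by omega, _, hf.cons hsymm hbb hbf⟩
  have h2 : (1 : ZMod 2) + 1 = 0 := by decide
  set v := f 0 with hv
  have hvv : B v v = 1 := by simpa using hf 0 0
  have hav : B a v = 0 := haf 0
  have hbv : B b v = 0 := hbf 0
  have hva : B v a = 0 := by rw [hsymm, hav]
  have hvb : B v b = 0 := by rw [hsymm, hbv]
  have hba : B b a = 1 := by rw [hsymm, hab]
  have hg : IsOrthonormalFamily B (fun i : Fin l => f i.succ) := by
    intro i j
    simpa using hf i.succ j.succ
  have hvg : ∀ i : Fin l, B v (f i.succ) = 0 := fun i => by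
    simpa [(Fin.succ_ne_zero i).symm] using hf 0 i.succ
  have h1 := hg.cons hsymm (a := v + a) (by simp [hvv, hav, hva, haa])
    (fun i => by simp [hvg, haf])
  have h3 := h1.cons hsymm (a := v + b) (by simp [hvv, hvb, hbv, hbb])
    (fun i => by
      refine Fin.cases ?_ (fun i => ?_) i
      · simp [hvv, hva, hbv, hba, h2]
      · simp [hvg, hbf])
  have h4 := h3.cons hsymm (a := v + a + b)
    (by simp [hvv, hva, hvb, hav, haa, hab, hbv, hba, hbb, h2])
    (fun i => by
      refine Fin.cases ?_ (fun i => Fin.cases ?_ (fun i => ?_) i) i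
      · simp [hvv, hvb, hav, hab, hbv, hbb, h2]
      · simp [hvv, hva, hav, haa, hbv, hba, h2]
      · simp [hvg, haf, hbf])
  exact ⟨l + 3, by omega, _, h4⟩

/-- A nondegenerate symmetric bilinear form over `𝔽₂` which is not alternating has an orthonormal
basis. -/
lemma exists_orthonormal_basis [Finite V] (hsymm : ∀ x y, B x y = B y x)
    (hnd : ∀ x, x ≠ 0 → ∃ y, B x y = 1) (hna : ∃ v, B v v = 1) :
    ∃ (l : ℕ) (b : Module.Basis (Fin l) (ZMod 2) V), IsOrthonormalFamily B b := by
  by_contra hcon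
  -- Without an orthonormal basis every orthonormal family could be enlarged; but such families are
  -- independent, hence injective into the finite V.
  have hbig : ∀ N : ℕ, ∃ l ≥ N, ∃ f : Fin (l + 1) → V, IsOrthonormalFamily B f := by
    intro N
    induction N with
    | zero =>
      obtain ⟨v, hv⟩ := hna
      refine ⟨0, le_rfl, fun _ => v, fun i j => ?_⟩
      obtain rfl : i = j := Fin.ext (by omega)
      simpa using hv
    | succ N ih =>
      obtain ⟨l, hl, f, hf⟩ := ih
      by_cases hspan : ∀ x, orthogonalPart B f x = 0
      · refine absurd ⟨l + 1, Module.Basis.mk hf.linearIndependent ?_, ?_⟩ hcon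
        · intro x _
          rw [sub_eq_zero.1 (hspan x)]
          exact Submodule.sum_mem _ fun j _ =>
            Submodule.smul_mem _ _ (Submodule.subset_span ⟨j, rfl⟩)
        · rw [Module.Basis.coe_mk]
          exact hf
      · push Not at hspan
        obtain ⟨x, hx⟩ := hspan
        obtain ⟨l', hl', f', hf'⟩ := hf.exists_larger hsymm hnd hx
        obtain ⟨l'', rfl⟩ : ∃ l'', l' = l'' + 1 := ⟨l' - 1, by omega⟩
        exact ⟨l'', by omega, f', hf'⟩
  obtain ⟨l, hl, f, hf⟩ := hbig (Nat.card V)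
  have h := Nat.card_le_card_of_injective f hf.linearIndependent.injective
  rw [Nat.card_eq_fintype_card, Fintype.card_fin] at h
  omega

/-- The extension of degree `m` of `𝔽₂` has a self-dual basis. -/
lemma exists_selfDual_basis {m : ℕ} (hm : m ≠ 0) :
    ∃ b : Module.Basis (Fin m) (ZMod 2) (GaloisField 2 m), ∀ i j,
      Algebra.trace (ZMod 2) (GaloisField 2 m) (b i * b j) = if i = j then 1 else 0 := by
  obtain ⟨t, ht⟩ := Algebra.trace_surjective (ZMod 2) (GaloisField 2 m) 1
  obtain ⟨l, b, hb⟩ := exists_orthonormal_basis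
    (B := Algebra.traceForm (ZMod 2) (GaloisField 2 m))
    (fun x y => by rw [Algebra.traceForm_apply, Algebra.traceForm_apply, mul_comm])
    (fun x hx => ⟨x⁻¹ * t, by rw [Algebra.traceForm_apply, mul_inv_cancel_left₀ hx, ht]⟩)
    (by
      -- The form is not alternating: an element of trace 1 is a square v·v in characteristic 2.
      obtain ⟨v, hv⟩ := FiniteField.isSquare_of_char_two (ringChar.eq (GaloisField 2 m) 2) t
      exact ⟨v, by rw [Algebra.traceForm_apply, ← hv, ht]⟩)
  have hl : l = m := by
    rw [← GaloisField.finrank 2 hm, Module.finrank_eq_card_basis b, Fintype.card_fin]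
  subst hl
  exact ⟨b, hb⟩

lemma exists_primitive_element {m : ℕ} (hm : m ≠ 0) :
    ∃ α : GaloisField 2 m, IsPrimitiveRoot α (2 ^ m - 1) := by
  obtain ⟨g, hg⟩ := IsCyclic.exists_generator (α := (GaloisField 2 m)ˣ)
  refine ⟨g, IsPrimitiveRoot.coe_units_iff.2 ?_⟩
  have h := IsPrimitiveRoot.orderOf g
  rwa [orderOf_eq_card_of_forall_mem_zpowers hg, Nat.card_units, GaloisField.card 2 m hm] at h

end SelfDualBasis

/-! ### Reed–Solomon codes: dimension, self-orthogonality, dual distance -/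

section ReedSolomon

open Polynomial

variable {K : Type} [Field K] {n : ℕ} {α : K}

lemma eval_prim_injective (hα : IsPrimitiveRoot α n) :
    Function.Injective fun j : Fin n => α ^ (j : ℕ) :=
  fun i j h => Fin.ext (hα.pow_inj i.2 j.2 h)

/-- The roots αⁱ are distinct, so the linear factors are coprime and divisibility amounts to
vanishing at each root: these are the parity checks. -/
lemma mem_rsCode (hα : IsPrimitiveRoot α n) {d : ℕ} (hd : d - 1 ≤ n) {c : Fin n → K} :
    c ∈ rsCode n α d ↔ ∀ i < d - 1, ∑ j : Fin n, (α ^ i) ^ (j : ℕ) * c j = 0 := by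
  have heval : ∀ i, eval (α ^ i) (∑ j : Fin n, C (c j) * X ^ (j : ℕ)) =
      ∑ j : Fin n, (α ^ i) ^ (j : ℕ) * c j := by
    intro i
    rw [eval_finsetSum]
    refine Finset.sum_congr rfl fun j _ => ?_
    rw [eval_mul, eval_C, eval_pow, eval_X, mul_comm]
  have hdvd : ∀ p : K[X], (∏ i ∈ Finset.range (d - 1), (X - C (α ^ i))) ∣ p ↔
      ∀ i < d - 1, eval (α ^ i) p = 0 := by
    intro p
    constructor
    · intro h i hi
      have h1 : (X - C (α ^ i)) ∣ p :=
        (Finset.dvd_prod_of_mem (fun i => X - C (α ^ i)) (Finset.mem_range.2 hi)).trans h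
      exact dvd_iff_isRoot.1 h1
    · intro h
      refine Finset.prod_dvd_of_coprime ?_ fun i hi =>
        dvd_iff_isRoot.2 (h i (Finset.mem_range.1 hi))
      intro i hi j hj hij
      refine isCoprime_X_sub_C_of_isUnit_sub (sub_ne_zero.2 fun h => hij ?_).isUnit
      rw [Finset.mem_coe, Finset.mem_range] at hi hj
      exact hα.pow_inj (by omega) (by omega) h
  refine (hdvd _).trans ?_
  simp only [heval]

/-- Evaluation at `1, α, α², …` of the polynomials `∑ₛ aₛ X^(s+1)`. -/
def rsEval (n k : ℕ) (α : K) : (Fin k → K) →ₗ[K] (Fin n → K) where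
  toFun a j := ∑ s : Fin k, (α ^ (j : ℕ)) ^ ((s : ℕ) + 1) * a s
  map_add' a b := by
    funext j
    simp [mul_add, Finset.sum_add_distrib]
  map_smul' c a := by
    funext j
    simp only [Pi.smul_apply, smul_eq_mul, RingHom.id_apply, Finset.mul_sum]
    exact Finset.sum_congr rfl fun s _ => by ring

lemma rsEval_apply (k : ℕ) (a : Fin k → K) (j : Fin n) :
    rsEval n k α a j = ∑ s : Fin k, (α ^ (j : ℕ)) ^ ((s : ℕ) + 1) * a s := rfl

lemma sum_pow_eq_zero (hα : IsPrimitiveRoot α n) {t : ℕ} (h0 : 0 < t) (ht : t < n) :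
    ∑ j : Fin n, (α ^ t) ^ (j : ℕ) = 0 := by
  rw [Fin.sum_univ_eq_sum_range (fun j => (α ^ t) ^ j)]
  have h := geom_sum_mul (α ^ t) n
  rw [← pow_mul, mul_comm t n, pow_mul, hα.pow_eq_one, one_pow, sub_self] at h
  refine (mul_eq_zero.1 h).resolve_right (sub_ne_zero.2 fun h1 => ?_)
  exact absurd (Nat.le_of_dvd h0 (hα.dvd_of_pow_eq_one t h1)) (by omega)

lemma rsEval_injective (hα : IsPrimitiveRoot α n) {k : ℕ} (hk : k ≤ n) (hn : 0 < n) :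
    Function.Injective (rsEval n k α) := by
  rw [injective_iff_map_eq_zero]
  intro a ha
  have hα0 : α ≠ 0 := hα.ne_zero hn.ne'
  refine Matrix.eq_zero_of_forall_index_sum_pow_mul_eq_zero
    (f := fun j : Fin k => α ^ (j : ℕ)) ?_ fun j => ?_
  · exact fun i j h => Fin.ext (hα.pow_inj (by omega) (by omega) h)
  · have h := congrFun ha (Fin.castLE hk j)
    rw [rsEval_apply, Pi.zero_apply] at h
    have h2 : α ^ (j : ℕ) * ∑ i : Fin k, (α ^ (j : ℕ)) ^ (i : ℕ) * a i = 0 := by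
      rw [Finset.mul_sum, ← h]
      exact Finset.sum_congr rfl fun s _ => by rw [Fin.val_castLE]; ring
    exact (mul_eq_zero.1 h2).resolve_left (pow_ne_zero _ hα0)

/-- The Reed--Solomon code of dimension `k` as an evaluation code. -/
lemma range_rsEval (hα : IsPrimitiveRoot α n) {k : ℕ} (hk : k ≤ n) (hn : 0 < n) :
    LinearMap.range (rsEval n k α) = rsCode n α (n - k + 1) := by
  have hle : LinearMap.range (rsEval n k α) ≤ rsCode n α (n - k + 1) := by
    rintro _ ⟨a, rfl⟩
    rw [mem_rsCode hα (by omega)]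
    intro i hi
    simp only [rsEval_apply, Finset.mul_sum]
    rw [Finset.sum_comm]
    refine Finset.sum_eq_zero fun s _ => ?_
    -- Here i < n-k and s < k, so the exponent lies strictly between 0 and n. The shift by one in
    -- `rsEval` is what excludes the exponent 0.
    have h := sum_pow_eq_zero hα (t := i + (s + 1)) (by omega) (by have := s.2; omega)
    calc ∑ j : Fin n, (α ^ i) ^ (j : ℕ) * ((α ^ (j : ℕ)) ^ ((s : ℕ) + 1) * a s)
        = (∑ j : Fin n, (α ^ (i + (s + 1))) ^ (j : ℕ)) * a s := by
          rw [Finset.sum_mul]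
          exact Finset.sum_congr rfl fun j _ => by ring
      _ = 0 := by rw [h, zero_mul]
  refine Submodule.eq_of_le_of_finrank_le hle ?_
  rw [LinearMap.finrank_range_of_inj (rsEval_injective hα hk hn), Module.finrank_fin_fun]
  -- The k power sums not among the parity checks. If they vanish too, the full Vandermonde system
  -- forces c = 0, so the code has dimension at most k.
  let L : (Fin n → K) →ₗ[K] (Fin k → K) :=
    { toFun := fun c i => ∑ j : Fin n, (α ^ (n - k + (i : ℕ))) ^ (j : ℕ) * c j
      map_add' := fun a b => by
        funext i
        simp [mul_add, Finset.sum_add_distrib]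
      map_smul' := fun r a => by
        funext i
        simp only [Pi.smul_apply, smul_eq_mul, RingHom.id_apply, Finset.mul_sum]
        exact Finset.sum_congr rfl fun s _ => by ring }
  have hinj : Function.Injective (L.comp (rsCode n α (n - k + 1)).subtype) := by
    rw [injective_iff_map_eq_zero]
    rintro ⟨c, hc⟩ h
    rw [mem_rsCode hα (by omega)] at hc
    refine Subtype.ext (Matrix.eq_zero_of_forall_index_sum_pow_mul_eq_zero
      (eval_prim_injective hα) fun i => ?_)
    by_cases hi : (i : ℕ) < n - k
    · exact hc i (by omega)
    · have h1 := congrFun h ⟨i - (n - k), by have := i.2; omega⟩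
      have h2 : n - k + ((i : ℕ) - (n - k)) = i := by omega
      change ∑ j : Fin n, (α ^ (n - k + ((i : ℕ) - (n - k)))) ^ (j : ℕ) * c j = 0 at h1
      rwa [h2] at h1
  simpa using LinearMap.finrank_le_finrank_of_injective hinj

lemma natCard_rsCode (hα : IsPrimitiveRoot α n) {k : ℕ} (hk : k ≤ n) (hn : 0 < n) :
    Nat.card (rsCode n α (n - k + 1)) = Nat.card K ^ k := by
  rw [← range_rsEval hα hk hn,
    ← Nat.card_congr (LinearEquiv.ofInjective _ (rsEval_injective hα hk hn)).toEquiv, Nat.card_fun,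
    Nat.card_fin]

/-- A product of two codewords is the evaluation of a polynomial with exponents from 2 to 2k < n,
and each such power sums to zero over the n-th roots of unity. -/
lemma rsCode_orthogonal (hα : IsPrimitiveRoot α n) {k : ℕ} (hk : 2 * k < n) {c c' : Fin n → K}
    (hc : c ∈ rsCode n α (n - k + 1)) (hc' : c' ∈ rsCode n α (n - k + 1)) :
    ∑ j, c j * c' j = 0 := by
  rw [← range_rsEval hα (by omega) (by omega)] at hc hc'
  obtain ⟨a, rfl⟩ := hc
  obtain ⟨b, rfl⟩ := hc'
  simp only [rsEval_apply, Finset.sum_mul_sum]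
  rw [Finset.sum_comm]
  refine Finset.sum_eq_zero fun s _ => ?_
  rw [Finset.sum_comm]
  refine Finset.sum_eq_zero fun t _ => ?_
  have h := sum_pow_eq_zero hα (t := s + 1 + (t + 1)) (by omega)
    (by have := s.2; have := t.2; omega)
  calc _ = (∑ j : Fin n, (α ^ ((s : ℕ) + 1 + (t + 1))) ^ (j : ℕ)) * (a s * b t) := by
        rw [Finset.sum_mul]
        exact Finset.sum_congr rfl fun j _ => by ring
    _ = 0 := by rw [h, zero_mul]

open Classical in
/-- The dual of the Reed--Solomon code of dimension `k` has minimum distance at least `k + 1`. -/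
lemma lt_hammingNorm_of_orthogonal (hα : IsPrimitiveRoot α n) {k : ℕ} (hk : k ≤ n)
    {y : Fin n → K} (hy : y ≠ 0) (horth : ∀ c ∈ rsCode n α (n - k + 1), ∑ j, y j * c j = 0) :
    k < hammingNorm y := by
  by_contra! hle
  obtain ⟨i, hi⟩ := Function.ne_iff.1 hy
  have hi' : y i ≠ 0 := hi
  have hn : 0 < n := i.pos
  have hα0 : α ≠ 0 := hα.ne_zero hn.ne'
  let S : Finset (Fin n) := Finset.univ.filter fun j => y j ≠ 0
  have hS : S.card ≤ k := hle
  have hiS : i ∈ S := by simpa [S] using hi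
  -- P vanishes on the support of y except at i and has degree below k, so the codeword of X·P meets
  -- the support of y in i alone.
  let P : K[X] := ∏ j ∈ S.erase i, (X - C (α ^ (j : ℕ)))
  have hdeg : P.natDegree < k := by
    rw [natDegree_prod_of_monic _ _ fun j _ => monic_X_sub_C _]
    simp only [natDegree_X_sub_C, Finset.sum_const, smul_eq_mul, mul_one]
    have := Finset.card_erase_lt_of_mem hiS
    omega
  have hev : ∀ j : Fin n, rsEval n k α (fun s => P.coeff s) j =
      α ^ (j : ℕ) * P.eval (α ^ (j : ℕ)) := by
    intro j
    rw [eval_eq_sum_range' hdeg, Finset.mul_sum, rsEval_apply,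
      Fin.sum_univ_eq_sum_range (fun s => (α ^ (j : ℕ)) ^ (s + 1) * P.coeff s)]
    exact Finset.sum_congr rfl fun s _ => by ring
  have h := horth (rsEval n k α fun s => P.coeff s) (by
    rw [← range_rsEval hα hk hn]
    exact ⟨_, rfl⟩)
  rw [Finset.sum_eq_single i, hev] at h
  · refine mul_ne_zero hi' (mul_ne_zero (pow_ne_zero _ hα0) ?_) h
    rw [eval_prod, Finset.prod_ne_zero_iff]
    intro j hj
    rw [eval_sub, eval_X, eval_C, sub_ne_zero]
    exact fun h => (Finset.mem_erase.1 hj).1 (eval_prim_injective hα h).symm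
  · intro j _ hj
    rw [hev]
    by_cases hyj : y j = 0
    · rw [hyj, zero_mul]
    · rw [eval_prod, Finset.prod_eq_zero (i := j), mul_zero, mul_zero]
      · exact Finset.mem_erase.2 ⟨hj, by simpa [S] using hyj⟩
      · simp
  · simp

end ReedSolomon

/-! ### The outer quantum Reed–Solomon code -/

section Outer

variable {K : Type} [Field K] [Algebra (ZMod 2) K] {m n : ℕ}

/-- Collecting coordinates with respect to a basis. -/
noncomputable def collect (b : Module.Basis (Fin m) (ZMod 2) K) (n : ℕ) :
    (Fin n × Fin m → ZMod 2) ≃ (Fin n → K) :=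
  (Equiv.curry _ _ _).trans (Equiv.arrowCongr (Equiv.refl _) b.equivFun.symm.toEquiv)

lemma collect_apply (b : Module.Basis (Fin m) (ZMod 2) K) (x : Fin n × Fin m → ZMod 2) (i : Fin n) :
    collect b n x i = ∑ j, x (i, j) • b j := by
  change b.equivFun.symm (fun j => x (i, j)) = _
  rw [Module.Basis.equivFun_symm_apply]

lemma mem_binaryExpansion (b : Module.Basis (Fin m) (ZMod 2) K) (C : Submodule K (Fin n → K))
    (x : Fin n × Fin m → ZMod 2) : x ∈ binaryExpansion b C ↔ collect b n x ∈ C := by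
  have h : collect b n x = fun i => ∑ j, x (i, j) • b j := funext fun i => collect_apply b x i
  rw [h]
  rfl

lemma natCard_binaryExpansion (b : Module.Basis (Fin m) (ZMod 2) K)
    (C : Submodule K (Fin n → K)) : Nat.card (binaryExpansion b C) = Nat.card C :=
  Nat.card_congr ((collect b n).subtypeEquiv fun x => mem_binaryExpansion b C x)

lemma sum_mul_eq_trace {b : Module.Basis (Fin m) (ZMod 2) K}
    (hb : ∀ i j, Algebra.trace (ZMod 2) K (b i * b j) = if i = j then 1 else 0)
    (x y : Fin n × Fin m → ZMod 2) :
    ∑ p, x p * y p = Algebra.trace (ZMod 2) K (∑ i, collect b n x i * collect b n y i) := by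
  simp only [collect_apply, Finset.sum_mul_sum, smul_mul_smul_comm, map_sum, map_smul, hb,
    smul_eq_mul, mul_ite, mul_one, mul_zero, Finset.sum_ite_eq, Finset.mem_univ, if_true]
  rw [Fintype.sum_prod_type]

section Omega

variable {ι : Type} {ω : F4}

/-- The vector `ω x + ω² y`. -/
noncomputable def omegaVec (ω : F4) (x y : ι → ZMod 2) : ι → F4 := fun p =>
  ω * algebraMap (ZMod 2) F4 (x p) + ω ^ 2 * algebraMap (ZMod 2) F4 (y p)

lemma algebraMap_F4_sq (a : ZMod 2) : algebraMap (ZMod 2) F4 a ^ 2 = algebraMap (ZMod 2) F4 a := by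
  rcases ZMod.eq_zero_or_one_of_two a with rfl | rfl <;> simp

/-- On the basis ω, ω² of F4 the trace form is a hyperbolic plane. Orthogonality over F4 thereby
reduces to the ordinary binary inner product. -/
lemma traceInner_omegaVec [Fintype ι] (hω : ω ^ 2 = ω + 1) (x y x' y' : ι → ZMod 2) :
    traceInner (omegaVec ω x y) (omegaVec ω x' y') =
      algebraMap (ZMod 2) F4 (∑ p, x p * y' p + ∑ p, y p * x' p) := by
  rw [← Finset.sum_add_distrib, map_sum, traceInner]
  refine Finset.sum_congr rfl fun p _ => ?_
  have hsq : ∀ a b : ZMod 2,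
      (ω * algebraMap (ZMod 2) F4 a + ω ^ 2 * algebraMap (ZMod 2) F4 b) ^ 2 =
      ω ^ 2 * algebraMap (ZMod 2) F4 a + ω * algebraMap (ZMod 2) F4 b := by
    intro a b
    rw [CharTwo.add_sq]
    linear_combination ω ^ 2 * algebraMap_F4_sq a + ω ^ 4 * algebraMap_F4_sq b +
      algebraMap (ZMod 2) F4 b * F4.pow_four ω
  simp only [omegaVec]
  rw [hsq, hsq, map_add, map_mul, map_mul]
  have h4 : ω ^ 2 + ω ^ 4 = 1 := by
    linear_combination hω + F4.pow_four ω + ω * F4.two_eq_zero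
  linear_combination (algebraMap (ZMod 2) F4 (x p) * algebraMap (ZMod 2) F4 (y' p) +
    algebraMap (ZMod 2) F4 (y p) * algebraMap (ZMod 2) F4 (x' p)) * h4 +
    ω ^ 3 * (algebraMap (ZMod 2) F4 (x p) * algebraMap (ZMod 2) F4 (x' p) +
    algebraMap (ZMod 2) F4 (y p) * algebraMap (ZMod 2) F4 (y' p)) * F4.two_eq_zero

lemma omega_comb_injective (hω : ω ^ 2 = ω + 1) : Function.Injective fun p : ZMod 2 × ZMod 2 =>
    ω * algebraMap (ZMod 2) F4 p.1 + ω ^ 2 * algebraMap (ZMod 2) F4 p.2 := by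
  have h0 : ω ≠ 0 := by
    rintro rfl
    rw [zero_add, zero_pow two_ne_zero] at hω
    exact zero_ne_one hω
  have h1 : ω ^ 2 ≠ 0 := pow_ne_zero _ h0
  have h3 : ω + ω ^ 2 = 1 := by linear_combination hω + ω * F4.two_eq_zero
  have key : ∀ a b : ZMod 2, ω * algebraMap (ZMod 2) F4 a + ω ^ 2 * algebraMap (ZMod 2) F4 b = 0 →
      a = 0 ∧ b = 0 := by
    intro a b h
    rcases ZMod.eq_zero_or_one_of_two a with rfl | rfl <;>
    rcases ZMod.eq_zero_or_one_of_two b with rfl | rfl <;>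
    simp only [map_zero, map_one, mul_zero, mul_one, zero_add, add_zero] at h
    · exact ⟨rfl, rfl⟩
    · exact absurd h h1
    · exact absurd h h0
    · exact absurd (h3.symm.trans h) one_ne_zero
  rintro ⟨a, b⟩ ⟨c, d⟩ h
  have h' : ω * algebraMap (ZMod 2) F4 a + ω ^ 2 * algebraMap (ZMod 2) F4 b =
    ω * algebraMap (ZMod 2) F4 c + ω ^ 2 * algebraMap (ZMod 2) F4 d := h
  obtain ⟨h1, h2⟩ := key (a - c) (b - d) (by
    rw [map_sub, map_sub]
    linear_combination h')
  rw [sub_eq_zero.1 h1, sub_eq_zero.1 h2]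

lemma omegaVec_bijective (hω : ω ^ 2 = ω + 1) :
    Function.Bijective fun p : (ι → ZMod 2) × (ι → ZMod 2) => omegaVec ω p.1 p.2 := by
  have hbij := (Fintype.bijective_iff_injective_and_card _).2 ⟨omega_comb_injective hω, by
    rw [F4.card, Fintype.card_prod, ZMod.card]⟩
  constructor
  · rintro ⟨x, y⟩ ⟨x', y'⟩ h
    have h1 : ∀ p, (x p, y p) = (x' p, y' p) := fun p => hbij.1 (congrFun h p)
    simp only [Prod.mk.injEq] at h1
    exact Prod.ext (funext fun p => (h1 p).1) (funext fun p => (h1 p).2)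
  · intro u
    choose f hf using fun p => hbij.2 (u p)
    exact ⟨(fun p => (f p).1, fun p => (f p).2), funext hf⟩

lemma natCard_omegaCode (hω : ω ^ 2 = ω + 1) (B : AddSubgroup (ι → ZMod 2)) :
    Nat.card (omegaCode ω B) = Nat.card B * Nat.card B := by
  rw [← Nat.card_prod]
  symm
  refine Nat.card_congr (Equiv.ofBijective
    (fun p => ⟨omegaVec ω p.1.1 p.2.1, p.1.1, p.1.2, p.2.1, p.2.2, rfl⟩) ⟨?_, ?_⟩)
  · rintro ⟨⟨x, hx⟩, ⟨y, hy⟩⟩ ⟨⟨x', hx'⟩, ⟨y', hy'⟩⟩ h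
    have h1 := (omegaVec_bijective hω).1 (a₁ := (x, y)) (a₂ := (x', y')) (congrArg Subtype.val h)
    simp only [Prod.mk.injEq] at h1
    simp [h1.1, h1.2]
  · rintro ⟨_, x, hx, y, hy, rfl⟩
    exact ⟨(⟨x, hx⟩, ⟨y, hy⟩), rfl⟩

/-- Test vectors with one component zero separate the two conditions. -/
lemma omegaVec_mem_traceDual [Fintype ι] (hω : ω ^ 2 = ω + 1) {B : AddSubgroup (ι → ZMod 2)}
    {x y : ι → ZMod 2} : omegaVec ω x y ∈ traceDual (omegaCode ω B) ↔
      (∀ z ∈ B, ∑ p, x p * z p = 0) ∧ ∀ z ∈ B, ∑ p, y p * z p = 0 := by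
  have hinj := (algebraMap (ZMod 2) F4).injective
  constructor
  · intro h
    constructor <;> intro z hz
    · have h1 := h (omegaVec ω 0 z) ⟨0, B.zero_mem, z, hz, rfl⟩
      rw [traceInner_omegaVec hω, map_eq_zero_iff _ hinj] at h1
      simpa using h1
    · have h1 := h (omegaVec ω z 0) ⟨z, hz, 0, B.zero_mem, rfl⟩
      rw [traceInner_omegaVec hω, map_eq_zero_iff _ hinj] at h1
      simpa using h1
  · rintro ⟨hx, hy⟩ _ ⟨x', hx', y', hy', rfl⟩
    change traceInner (omegaVec ω x y) (omegaVec ω x' y') = 0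
    rw [traceInner_omegaVec hω, hx y' hy', hy x' hx', add_zero, map_zero]

end Omega

variable {α : K} {b : Module.Basis (Fin m) (ZMod 2) K} {ω : F4} {k : ℕ}

/-- The quantum Reed--Solomon code is an `[[nm, m(n - 2k)]]` stabilizer code. -/
lemma isStabilizerCode_outer (hα : IsPrimitiveRoot α n)
    (hb : ∀ i j, Algebra.trace (ZMod 2) K (b i * b j) = if i = j then 1 else 0)
    (hω : ω ^ 2 = ω + 1) (hk : 2 * k < n) :
    IsStabilizerCode (omegaCode ω (binaryExpansion b (rsCode n α (n - k + 1))))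
      (m * (n - 2 * k)) := by
  have horth : ∀ x ∈ binaryExpansion b (rsCode n α (n - k + 1)),
      ∀ y ∈ binaryExpansion b (rsCode n α (n - k + 1)), ∑ p, x p * y p = 0 := by
    intro x hx y hy
    rw [sum_mul_eq_trace hb, rsCode_orthogonal hα hk ((mem_binaryExpansion b _ x).1 hx)
      ((mem_binaryExpansion b _ y).1 hy), map_zero]
  refine ⟨?_, ?_⟩
  · rintro _ ⟨x, hx, y, hy, rfl⟩
    exact (omegaVec_mem_traceDual hω).2 ⟨horth x hx, horth y hy⟩
  · have hK : Nat.card K = 2 ^ m := by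
      rw [Nat.card_congr b.equivFun.toEquiv, Nat.card_fun]
      simp
    rw [natCard_omegaCode hω, natCard_binaryExpansion, natCard_rsCode hα (by omega) (by omega), hK,
      Fintype.card_prod, Fintype.card_fin, Fintype.card_fin, ← pow_mul, ← pow_add, ← pow_add]
    congr 1
    rw [← mul_add, ← mul_add, mul_comm n m]
    congr 1
    omega

open Classical in
/-- A nonzero vector in the dual of the quantum Reed--Solomon code has more than `k` nonzero
blocks. -/
lemma lt_card_blocks_outer (hα : IsPrimitiveRoot α n)
    (hb : ∀ i j, Algebra.trace (ZMod 2) K (b i * b j) = if i = j then 1 else 0)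
    (hω : ω ^ 2 = ω + 1) (hk : k ≤ n) {v : Fin n × Fin m → F4}
    (hv : v ∈ traceDual (omegaCode ω (binaryExpansion b (rsCode n α (n - k + 1)))))
    (hv0 : v ≠ 0) :
    k < (Finset.univ.filter fun i => (fun j => v (i, j)) ≠ 0).card := by
  have htr : ∃ t, Algebra.trace (ZMod 2) K t = 1 := by
    obtain ⟨p, -⟩ := Function.ne_iff.1 hv0
    exact ⟨_, (hb p.2 p.2).trans (if_pos rfl)⟩
  have hweight : ∀ x : Fin n × Fin m → ZMod 2, x ≠ 0 →
      (∀ z ∈ binaryExpansion b (rsCode n α (n - k + 1)), ∑ p, x p * z p = 0) →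
      k < hammingNorm (collect b n x) := by
    intro x hx hxz
    have hc0 : collect b n 0 = 0 := by
      funext i
      rw [collect_apply]
      simp
    refine lt_hammingNorm_of_orthogonal hα hk
      (fun h => hx ((collect b n).injective (h.trans hc0.symm))) fun c hc => ?_
    -- Were the K-inner product e nonzero, the multiple (e⁻¹t)c, still a codeword by K-linearity,
    -- would have inner product t with x, of trace 1 instead of 0.
    by_contra hne
    obtain ⟨t, ht⟩ := htr
    set e := ∑ j, collect b n x j * c j with he
    have hmem := (rsCode n α (n - k + 1)).smul_mem (e⁻¹ * t) hc
    have h1 := hxz ((collect b n).symm ((e⁻¹ * t) • c)) (by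
      rw [mem_binaryExpansion, Equiv.apply_symm_apply]
      exact hmem)
    rw [sum_mul_eq_trace hb, Equiv.apply_symm_apply] at h1
    have h2 : ∑ i, collect b n x i * ((e⁻¹ * t) • c) i = t := by
      calc _ = e⁻¹ * t * e := by
            rw [he, Finset.mul_sum]
            exact Finset.sum_congr rfl fun j _ => by
              rw [Pi.smul_apply, smul_eq_mul]; ring
        _ = t := by rw [mul_right_comm, inv_mul_cancel₀ hne, one_mul]
    rw [h2, ht] at h1
    exact one_ne_zero h1
  obtain ⟨⟨x, y⟩, rfl⟩ := (omegaVec_bijective hω).2 v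
  obtain ⟨hx, hy⟩ := (omegaVec_mem_traceDual hω).1 hv
  have hblock : ∀ i, (fun j => omegaVec ω x y (i, j)) = 0 →
      ∀ j, x (i, j) = 0 ∧ y (i, j) = 0 := by
    intro i h j
    have h1 := omega_comb_injective hω (a₁ := (x (i, j), y (i, j))) (a₂ := (0, 0))
      (by simpa [omegaVec] using congrFun h j)
    simpa using h1
  have hsub : ∀ z : Fin n × Fin m → ZMod 2, (∀ i, (fun j => omegaVec ω x y (i, j)) = 0 →
      ∀ j, z (i, j) = 0) → hammingNorm (collect b n z) ≤
      (Finset.univ.filter fun i => (fun j => omegaVec ω x y (i, j)) ≠ 0).card := by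
    intro z hz
    refine Finset.card_le_card fun i hi => ?_
    rw [Finset.mem_filter] at hi ⊢
    refine ⟨Finset.mem_univ _, fun h => hi.2 ?_⟩
    rw [collect_apply]
    exact Finset.sum_eq_zero fun j _ => by rw [hz i h j, zero_smul]
  -- One of the components x, y is nonzero, and its nonzero blocks are among those of v.
  by_cases hx0 : x = 0
  · refine (hweight y (fun hy0 => hv0 ?_) hy).trans_le (hsub y fun i h j => (hblock i h j).2)
    funext p
    simp [hx0, hy0, omegaVec]
  · exact (hweight x hx0 hx).trans_le (hsub x fun i h j => (hblock i h j).1)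

end Outer

end QuantumCode
namespace QuantumCode

/-! ### Concatenation: size, self-orthogonality, distance -/

section Concat

variable {n m n₂ : ℕ} {C₁ : AddSubgroup (Fin n × Fin m → F4)} {C₂ : AddSubgroup (Fin n₂ → F4)}
  {ρ : (Fin m → F4) ≃+ traceDual C₂ ⧸ C₂.addSubgroupOf (traceDual C₂)}

lemma traceInner_prod {ι κ : Type} [Fintype ι] [Fintype κ] (u v : ι × κ → F4) :
    traceInner u v = ∑ i, traceInner (fun j => u (i, j)) (fun j => v (i, j)) :=
  Fintype.sum_prod_type _

lemma quotient_mk_eq_iff {u v : traceDual C₂} :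
    (QuotientAddGroup.mk u : traceDual C₂ ⧸ C₂.addSubgroupOf (traceDual C₂)) =
      QuotientAddGroup.mk v ↔ (v : Fin n₂ → F4) - u ∈ C₂ := by
  rw [QuotientAddGroup.eq, AddSubgroup.mem_addSubgroupOf, neg_add_eq_sub]
  rfl

lemma exists_representatives (v : Fin n × Fin m → F4) :
    ∃ u : Fin n → traceDual C₂, ∀ i, ρ (fun j => v (i, j)) = QuotientAddGroup.mk (u i) := by
  choose u hu using fun i => QuotientAddGroup.mk_surjective (ρ fun j => v (i, j))
  exact ⟨u, fun i => (hu i).symm⟩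

lemma concatCode_le_traceDual
    (hρ : ∀ (a b : Fin m → F4) (u v : traceDual C₂),
      ρ a = QuotientAddGroup.mk u → ρ b = QuotientAddGroup.mk v →
      traceInner (u : Fin n₂ → F4) (v : Fin n₂ → F4) = traceInner a b)
    (h₁ : C₁ ≤ traceDual C₁) : concatCode C₁ C₂ ρ ≤ traceDual (concatCode C₁ C₂ ρ) := by
  rintro c ⟨v, hv, u, hu, hc⟩ c' ⟨v', hv', u', hu', hc'⟩
  rw [← h₁ hv v' hv', traceInner_prod, traceInner_prod]
  refine Finset.sum_congr rfl fun i _ => ?_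
  simp only [hc, hc']
  exact hρ _ _ _ _ (hu i) (hu' i)

/-- Once a representative of every class is fixed, a codeword amounts to an outer codeword and n
independent elements of C₂. -/
lemma natCard_concatCode (h₂ : C₂ ≤ traceDual C₂) :
    Nat.card (concatCode C₁ C₂ ρ) = Nat.card C₁ * Nat.card C₂ ^ n := by
  choose σ hσ using fun a => QuotientAddGroup.mk_surjective (ρ a)
  let f : C₁ × (Fin n → C₂) → concatCode C₁ C₂ ρ := fun p =>
    ⟨fun q => (σ (fun j => p.1.1 (q.1, j)) : Fin n₂ → F4) q.2 + (p.2 q.1 : Fin n₂ → F4) q.2,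
      p.1.1, p.1.2, fun i => σ (fun j => p.1.1 (i, j)) + ⟨p.2 i, h₂ (p.2 i).2⟩, fun i => by
        rw [← hσ, quotient_mk_eq_iff]
        simp, fun i j => rfl⟩
  have hf : ∀ p q, (f p : Fin n × Fin n₂ → F4) q =
      (σ (fun j => p.1.1 (q.1, j)) : Fin n₂ → F4) q.2 + (p.2 q.1 : Fin n₂ → F4) q.2 :=
    fun _ _ => rfl
  have hbij : Function.Bijective f := by
    constructor
    · rintro p p' h
      have h1 : ∀ i, (σ (fun j => p.1.1 (i, j)) : Fin n₂ → F4) + p.2 i =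
          σ (fun j => p'.1.1 (i, j)) + p'.2 i := fun i => funext fun j => by
        have := congrFun (congrArg Subtype.val h) (i, j)
        rwa [hf, hf] at this
      have h2 : ∀ i, (fun j => p.1.1 (i, j)) = fun j => p'.1.1 (i, j) := by
        intro i
        apply ρ.injective
        rw [← hσ, ← hσ (fun j => p'.1.1 (i, j)), quotient_mk_eq_iff]
        have h3 : (σ (fun j => p'.1.1 (i, j)) : Fin n₂ → F4) - σ (fun j => p.1.1 (i, j)) =
            p.2 i - p'.2 i := by
          rw [sub_eq_sub_iff_add_eq_add, ← h1 i, add_comm]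
        rw [h3]
        exact C₂.sub_mem (p.2 i).2 (p'.2 i).2
      refine Prod.ext (Subtype.ext (funext fun q => congrFun (h2 q.1) q.2))
        (funext fun i => Subtype.ext ?_)
      have h3 := h1 i
      rw [h2 i] at h3
      exact add_left_cancel h3
    · rintro ⟨c, v, hv, u, hu, hc⟩
      have h1 : ∀ i, (u i : Fin n₂ → F4) - σ (fun j => v (i, j)) ∈ C₂ := fun i => by
        rw [← quotient_mk_eq_iff, hσ, hu]
      refine ⟨(⟨v, hv⟩, fun i => ⟨_, h1 i⟩), Subtype.ext (funext fun q => ?_)⟩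
      rw [hf]
      obtain ⟨i, j⟩ := q
      simp [hc]
  rw [← Nat.card_congr (Equiv.ofBijective f hbij), Nat.card_prod, Nat.card_fun, Nat.card_fin]

lemma isStabilizerCode_concatCode
    (hρ : ∀ (a b : Fin m → F4) (u v : traceDual C₂),
      ρ a = QuotientAddGroup.mk u → ρ b = QuotientAddGroup.mk v →
      traceInner (u : Fin n₂ → F4) (v : Fin n₂ → F4) = traceInner a b) {k : ℕ}
    (h₁ : IsStabilizerCode C₁ k) (h₂ : IsStabilizerCode C₂ m) :
    IsStabilizerCode (concatCode C₁ C₂ ρ) k := by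
  refine ⟨concatCode_le_traceDual hρ h₁.1, ?_⟩
  have hc₁ := h₁.2
  have hc₂ := h₂.2
  simp only [Fintype.card_prod, Fintype.card_fin] at hc₁ hc₂ ⊢
  rw [natCard_concatCode h₂.1, mul_right_comm, hc₁, mul_comm n m, pow_mul, ← mul_pow,
    mul_comm (2 ^ m), hc₂, ← pow_mul, mul_comm]

/-- A vector of C₂ placed in one block, with zeros elsewhere, is a codeword lying over the outer
word 0. -/
lemma concatCode_block_mem (h₂ : C₂ ≤ traceDual C₂) {x : Fin n × Fin n₂ → F4}
    (hx : x ∈ traceDual (concatCode C₁ C₂ ρ)) (i : Fin n) :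
    (fun j => x (i, j)) ∈ traceDual C₂ := by
  classical
  intro w hw
  have h := hx (fun q => if q.1 = i then w q.2 else 0) ⟨0, C₁.zero_mem,
    fun i' => if i' = i then ⟨w, h₂ hw⟩ else 0, fun i' => ?_, fun i' j => ?_⟩
  · rw [traceInner_prod, Finset.sum_eq_single i] at h
    · simpa using h
    · intro i' _ hi'
      simp only [hi', if_false]
      exact traceInner_zero_right _
    · simp
  · have h0 : ρ (fun j => (0 : Fin n × Fin m → F4) (i', j)) =
        QuotientAddGroup.mk (0 : traceDual C₂) := map_zero ρ
    rw [h0, quotient_mk_eq_iff]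
    by_cases hi : i' = i <;> simp [hi, hw, zero_mem]
  · by_cases hi : i' = i <;> simp [hi]

open Classical in
/-- The minimum distance of a concatenated code: if the nonzero vectors of the dual of the outer
code have at least `d₁` nonzero blocks, it is at least `d₁` times that of the inner code. -/
lemma mul_minDist_le_hammingNorm
    (hρ : ∀ (a b : Fin m → F4) (u v : traceDual C₂),
      ρ a = QuotientAddGroup.mk u → ρ b = QuotientAddGroup.mk v →
      traceInner (u : Fin n₂ → F4) (v : Fin n₂ → F4) = traceInner a b)
    (h₂ : C₂ ≤ traceDual C₂) {d₁ : ℕ}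
    (hd : ∀ v ∈ traceDual C₁, v ≠ 0 →
      d₁ ≤ (Finset.univ.filter fun i => (fun j => v (i, j)) ≠ 0).card)
    {x : Fin n × Fin n₂ → F4} (hx : x ∈ traceDual (concatCode C₁ C₂ ρ))
    (hx' : x ∉ concatCode C₁ C₂ ρ) : d₁ * minDist C₂ ≤ hammingNorm x := by
  let u : Fin n → traceDual C₂ := fun i => ⟨fun j => x (i, j), concatCode_block_mem h₂ hx i⟩
  let v : Fin n × Fin m → F4 := fun p => ρ.symm (QuotientAddGroup.mk (u p.1)) p.2
  have hv : ∀ i, ρ (fun j => v (i, j)) = QuotientAddGroup.mk (u i) := fun i =>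
    ρ.apply_symm_apply (QuotientAddGroup.mk (u i))
  have hvdual : v ∈ traceDual C₁ := by
    intro w hw
    obtain ⟨u', hu'⟩ := exists_representatives (ρ := ρ) w
    rw [← hx (fun q => (u' q.1 : Fin n₂ → F4) q.2) ⟨w, hw, u', hu', fun _ _ => rfl⟩,
      traceInner_prod, traceInner_prod]
    exact Finset.sum_congr rfl fun i _ => (hρ _ _ _ _ (hv i) (hu' i)).symm
  -- If v were 0, the word x would belong to the concatenated code, lying over the outer word 0.
  have hv0 : v ≠ 0 := fun h => hx' ⟨v, h ▸ C₁.zero_mem, u, hv, fun _ _ => rfl⟩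
  have hblock : ∀ i, (fun j => v (i, j)) ≠ 0 →
      minDist C₂ ≤ (Finset.univ.filter fun j => x (i, j) ≠ 0).card := by
    intro i hi
    refine Nat.sInf_le ⟨fun j => x (i, j), (u i).2, fun h => hi (ρ.injective ?_), rfl⟩
    rw [hv i, map_zero]
    refine (quotient_mk_eq_iff (v := 0)).2 ?_
    rw [AddSubgroup.coe_zero, zero_sub]
    exact C₂.neg_mem h
  calc d₁ * minDist C₂
      ≤ (Finset.univ.filter fun i => (fun j => v (i, j)) ≠ 0).card * minDist C₂ :=
        Nat.mul_le_mul_right _ (hd v hvdual hv0)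
    _ ≤ ∑ i ∈ Finset.univ.filter fun i => (fun j => v (i, j)) ≠ 0,
          (Finset.univ.filter fun j => x (i, j) ≠ 0).card := by
        rw [← smul_eq_mul]
        exact Finset.card_nsmul_le_sum _ _ _ fun i hi => hblock i (Finset.mem_filter.1 hi).2
    _ ≤ ∑ i, (Finset.univ.filter fun j => x (i, j) ≠ 0).card :=
        Finset.sum_le_univ_sum_of_nonneg fun _ => Nat.zero_le _
    _ = hammingNorm x := by
        simp only [hammingNorm, Finset.card_filter]
        rw [Fintype.sum_prod_type]

end Concat

/-! ### Minimum distance of codes with at least one encoded qubit -/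

section MinDist

variable {ι : Type} [Fintype ι] {C : AddSubgroup (ι → F4)}

/-- An `[[n, k]]` stabilizer code with `k ≥ 1` has `C^⊥ ≠ C`. -/
lemma IsStabilizerCode.exists_mem_traceDual_notMem {k : ℕ} (hC : IsStabilizerCode C k)
    (hk : 0 < k) : ∃ u ∈ traceDual C, u ∉ C := by
  by_contra! hle
  let _ : Module (ZMod 2) C := AddCommGroup.zmodModule fun x => by
    rw [two_nsmul]
    exact Subtype.ext (pi_add_self _)
  let e := Module.finBasis (ZMod 2) C
  have hcardC : Nat.card C = 2 ^ Module.finrank (ZMod 2) C := by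
    rw [Module.natCard_eq_pow_finrank (K := ZMod 2), Nat.card_zmod]
  have hker : ∀ x : ι → F4, (∀ i, traceInner x (e i) = 0) → x ∈ C := by
    intro x hx
    refine hle x fun c hc => ?_
    let f : C →+ F4 :=
      { toFun := fun c => traceInner x c
        map_zero' := traceInner_zero_right x
        map_add' := fun a b => traceInner_add_right x a b }
    change f ⟨c, hc⟩ = 0
    rw [← e.sum_repr ⟨c, hc⟩, map_sum]
    refine Finset.sum_eq_zero fun i _ => ?_
    rcases ZMod.eq_zero_or_one_of_two (e.repr ⟨c, hc⟩ i) with h | h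
    · rw [h, zero_smul, map_zero]
    · rw [h, one_smul]
      exact hx i
  -- The syndrome of x with respect to an 𝔽₂-basis of C. Equal syndromes differ by an element of
  -- C^⊥, hence of C under the assumption `hle`.
  let F : (ι → F4) → (Fin (Module.finrank (ZMod 2) C) → {x : F4 // x ^ 2 = x}) :=
    fun x i => ⟨traceInner x (e i), traceInner_sq _ _⟩
  choose σ hσ using fun y : Set.range F => y.2
  have hdiff : ∀ x, x - σ ⟨F x, x, rfl⟩ ∈ C := by
    intro x
    refine hker _ fun i => ?_
    have h := congrArg Subtype.val (congrFun (hσ ⟨F x, x, rfl⟩) i)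
    have h1 : traceInner (σ ⟨F x, x, rfl⟩) (e i) = traceInner x (e i) := h
    have h2 := traceInner_add_left (x - σ ⟨F x, x, rfl⟩) (σ ⟨F x, x, rfl⟩) (e i)
    rw [sub_add_cancel, h1] at h2
    simpa using h2.symm
  -- A vector is recovered from its syndrome and an element of C, so 4^n ≤ |C|², contradicting |C| <
  -- 2^n.
  have hinj : Function.Injective fun x : ι → F4 => (F x, (⟨_, hdiff x⟩ : C)) := by
    intro x y h
    have h1 : F x = F y := congrArg Prod.fst h
    have h2 : x - σ ⟨F x, x, rfl⟩ = y - σ ⟨F y, y, rfl⟩ :=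
      congrArg Subtype.val (congrArg Prod.snd h)
    simp only [h1] at h2
    exact sub_left_injective h2
  have h := Nat.card_le_card_of_injective _ hinj
  rw [Nat.card_prod, Nat.card_congr (Equiv.arrowCongr (Equiv.refl _) idempotentEquiv),
    Nat.card_fun, Nat.card_fun, Nat.card_fin, Nat.card_fin, F4.natCard, ← hcardC,
    Nat.card_eq_fintype_card (α := ι)] at h
  have h1 : Nat.card C < 2 ^ Fintype.card ι := by
    rw [← hC.2]
    exact lt_mul_of_one_lt_right Nat.card_pos (Nat.one_lt_two_pow hk.ne')
  have h2 : (4 : ℕ) ^ Fintype.card ι = 2 ^ Fintype.card ι * 2 ^ Fintype.card ι := by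
    rw [← mul_pow]; norm_num
  rw [h2] at h
  exact absurd h (not_le.2 (Nat.mul_self_lt_mul_self h1))

-- The infimum of the empty set of naturals is 0, so a lower bound needs C^⊥ \ C nonempty; this is
-- where k > 0 enters.
open Classical in
lemma IsStabilizerCode.le_minDist {k : ℕ} (hC : IsStabilizerCode C k) (hk : 0 < k) {d : ℕ}
    (hd : ∀ u ∈ traceDual C, u ∉ C → d ≤ hammingNorm u) : d ≤ minDist C := by
  obtain ⟨u, hu, hu'⟩ := hC.exists_mem_traceDual_notMem hk
  refine le_csInf ⟨_, u, hu, hu', rfl⟩ ?_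
  rintro _ ⟨w, hw, hw', rfl⟩
  exact hd w hw hw'

open Classical in
lemma IsStabilizerCode.minDist_le_card {k : ℕ} (hC : IsStabilizerCode C k) (hk : 0 < k) :
    minDist C ≤ Fintype.card ι := by
  obtain ⟨u, hu, hu'⟩ := hC.exists_mem_traceDual_notMem hk
  have h : hammingNorm u ∈ {w | ∃ u ∈ traceDual C, u ∉ C ∧ hammingNorm u = w} :=
    ⟨u, hu, hu', rfl⟩
  exact (Nat.sInf_le h).trans hammingNorm_le_card_fintype

end MinDist

end QuantumCode
namespace QuantumCode

/-! ### The entropy function, its inverse and Hamming balls -/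

section Entropy

lemma qEntropy_four_eq (x : ℝ) : qEntropy 4 x = Real.qaryEntropy 4 x / Real.log 4 := by
  have h4 : Real.log 4 ≠ 0 := (Real.log_pos (by norm_num)).ne'
  rcases eq_or_ne x 0 with rfl | hx
  · simp [qEntropy]
  · have h : Real.log (x / (4 - 1)) = Real.log x - Real.log 3 := by
      rw [Real.log_div hx (by norm_num)]
      norm_num
    simp only [qEntropy, Real.qaryEntropy, Real.binEntropy, Real.logb, Real.log_inv, Nat.cast_ofNat,
      h]
    have h3 : Real.log (((4 : ℤ) - 1 : ℤ) : ℝ) = Real.log 3 := by norm_num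
    rw [h3]
    field_simp
    ring

lemma qEntropy_four_zero : qEntropy 4 0 = 0 := by
  rw [qEntropy_four_eq, Real.qaryEntropy_zero, zero_div]

lemma qEntropy_four_three_quarters : qEntropy 4 (3 / 4) = 1 := by
  have h4 : Real.log 4 ≠ 0 := (Real.log_pos (by norm_num)).ne'
  have h1 : (3 / 4 : ℝ) / (((4 : ℕ) : ℝ) - 1) = 4⁻¹ := by norm_num
  have h2 : (1 : ℝ) - 3 / 4 = 4⁻¹ := by norm_num
  rw [qEntropy, h1, h2, Real.logb, Real.log_inv, Nat.cast_ofNat, neg_div, div_self h4]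
  norm_num

lemma continuous_qEntropy_four : Continuous (qEntropy 4) := by
  have h : qEntropy 4 = fun x => Real.qaryEntropy 4 x / Real.log 4 := funext qEntropy_four_eq
  rw [h]
  exact Real.qaryEntropy_continuous.div_const _

lemma strictMonoOn_qEntropy_four : StrictMonoOn (qEntropy 4) (Set.Icc 0 (3 / 4)) := by
  intro x hx y hy hxy
  rw [qEntropy_four_eq, qEntropy_four_eq]
  have h : (3 / 4 : ℝ) = 1 - 1 / ((4 : ℕ) : ℝ) := by norm_num
  rw [h] at hx hy
  exact div_lt_div_of_pos_right (Real.qaryEntropy_strictMonoOn (by norm_num) hx hy hxy)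
    (Real.log_pos (by norm_num))

/-- On this interval H₄ decreases to H₄(1) = log₄ 3 ≥ 1/2. This covers inner codes whose relative
distance lies beyond the increasing branch. -/
lemma half_le_qEntropy_four {x : ℝ} (hx : x ∈ Set.Icc (3 / 4 : ℝ) 1) : 1 / 2 ≤ qEntropy 4 x := by
  rw [qEntropy_four_eq, le_div_iff₀ (Real.log_pos (by norm_num))]
  have h : (3 / 4 : ℝ) = 1 - 1 / ((4 : ℕ) : ℝ) := by norm_num
  rw [h] at hx
  have h1 := (Real.qaryEntropy_strictAntiOn (q := 4) (by norm_num)).antitoneOn hx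
    ⟨by norm_num, le_rfl⟩ hx.2
  rw [Real.qaryEntropy_one] at h1
  have h3 : Real.log (((4 : ℕ) : ℤ) - 1 : ℤ) = Real.log 3 := by norm_num
  rw [h3] at h1
  have h2 : Real.log 4 = 2 * Real.log 2 := by
    rw [show (4 : ℝ) = 2 ^ 2 by norm_num, Real.log_pow]
    norm_num
  have h5 : Real.log 2 ≤ Real.log 3 := Real.log_le_log (by norm_num) (by norm_num)
  linarith

lemma surjOn_qEntropy_four : Set.SurjOn (qEntropy 4) (Set.Icc 0 (3 / 4)) (Set.Icc 0 1) := by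
  have h := intermediate_value_Icc (by norm_num : (0 : ℝ) ≤ 3 / 4)
    continuous_qEntropy_four.continuousOn
  rwa [qEntropy_four_zero, qEntropy_four_three_quarters] at h

lemma mapsTo_qEntropy_four : Set.MapsTo (qEntropy 4) (Set.Icc 0 (3 / 4)) (Set.Icc 0 1) := by
  intro x hx
  rw [← qEntropy_four_zero, ← qEntropy_four_three_quarters]
  exact ⟨strictMonoOn_qEntropy_four.monotoneOn ⟨le_rfl, by norm_num⟩ hx hx.1,
    strictMonoOn_qEntropy_four.monotoneOn hx ⟨by norm_num, le_rfl⟩ hx.2⟩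

lemma entropyInv4_mem {y : ℝ} (hy : y ∈ Set.Icc (0 : ℝ) 1) :
    entropyInv4 y ∈ Set.Icc (0 : ℝ) (3 / 4) :=
  surjOn_qEntropy_four.mapsTo_invFunOn hy

lemma qEntropy_entropyInv4 {y : ℝ} (hy : y ∈ Set.Icc (0 : ℝ) 1) :
    qEntropy 4 (entropyInv4 y) = y :=
  surjOn_qEntropy_four.rightInvOn_invFunOn hy

lemma entropyInv4_qEntropy {x : ℝ} (hx : x ∈ Set.Icc (0 : ℝ) (3 / 4)) :
    entropyInv4 (qEntropy 4 x) = x :=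
  strictMonoOn_qEntropy_four.injOn.leftInvOn_invFunOn hx

lemma entropyInv4_mono : MonotoneOn entropyInv4 (Set.Icc 0 1) := by
  intro x hx y hy hxy
  rw [← strictMonoOn_qEntropy_four.le_iff_le (entropyInv4_mem hx) (entropyInv4_mem hy),
    qEntropy_entropyInv4 hx, qEntropy_entropyInv4 hy]
  exact hxy

lemma entropyInv4_pos {y : ℝ} (hy0 : 0 < y) (hy1 : y ≤ 1) : 0 < entropyInv4 y := by
  refine lt_of_le_of_ne (entropyInv4_mem ⟨hy0.le, hy1⟩).1 fun h => ?_
  have h1 := qEntropy_entropyInv4 ⟨hy0.le, hy1⟩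
  rw [← h, qEntropy_four_zero] at h1
  exact hy0.ne h1

lemma entropyInv4_zero : entropyInv4 0 = 0 := by
  have h := entropyInv4_qEntropy (x := 0) ⟨le_rfl, by norm_num⟩
  rwa [qEntropy_four_zero] at h

/-- A continuous bijection from a compact space onto a Hausdorff space is a homeomorphism. -/
lemma continuousOn_entropyInv4 : ContinuousOn entropyInv4 (Set.Icc 0 1) := by
  let e : Set.Icc (0 : ℝ) (3 / 4) ≃ Set.Icc (0 : ℝ) 1 :=
    { toFun := fun x => ⟨qEntropy 4 x, mapsTo_qEntropy_four x.2⟩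
      invFun := fun y => ⟨entropyInv4 y, entropyInv4_mem y.2⟩
      left_inv := fun x => Subtype.ext (entropyInv4_qEntropy x.2)
      right_inv := fun y => Subtype.ext (qEntropy_entropyInv4 y.2) }
  have he : Continuous e :=
    (continuous_qEntropy_four.comp continuous_subtype_val).subtype_mk _
  rw [continuousOn_iff_continuous_domRestrict]
  exact continuous_subtype_val.comp (he.homeoOfEquivCompactToT2).symm.continuous

/-- If `δ ≥ H₄⁻¹(y)` and `y ≤ 1 / 2`, then `H₄(δ) ≥ y`. -/
lemma le_qEntropy_of_entropyInv4_le {y δ : ℝ} (hy0 : 0 ≤ y) (hy : y ≤ 1 / 2)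
    (hδ : entropyInv4 y ≤ δ) (hδ1 : δ ≤ 1) : y ≤ qEntropy 4 δ := by
  have hy1 : y ∈ Set.Icc (0 : ℝ) 1 := ⟨hy0, by linarith⟩
  rcases le_total δ (3 / 4) with h | h
  · have := strictMonoOn_qEntropy_four.monotoneOn (entropyInv4_mem hy1)
      ⟨(entropyInv4_mem hy1).1.trans hδ, h⟩ hδ
    rwa [qEntropy_entropyInv4 hy1] at this
  · exact hy.trans (half_le_qEntropy_four ⟨h, hδ1⟩)

open Classical in
/-- The volume of a Hamming ball of relative radius `p ≤ 3 / 4` is at most `4 ^ (n H₄(p))`. -/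
lemma card_ball_le (n : ℕ) {p : ℝ} (hp0 : 0 < p) (hp : p ≤ 3 / 4) :
    ((Finset.univ.filter fun x : Fin n → F4 => (hammingNorm x : ℝ) ≤ n * p).card : ℝ) ≤
      (4 : ℝ) ^ (n * qEntropy 4 p) := by
  set L := Real.log (1 - p) with hL
  set M := Real.log (p / 3) with hM
  have hML : M ≤ L := Real.log_le_log (by positivity) (by linarith)
  -- A probability distribution: mass 1-p on 0 and p/3 on each other symbol. As p ≤ 3/4 makes p/3 ≤
  -- 1-p, words of weight at most np have product mass at least 4^(-nH₄(p)), and the masses sum to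
  -- 1.
  let w : F4 → ℝ := fun x => if x = 0 then Real.exp L else Real.exp M
  have hw : ∑ x, w x = 1 := by
    rw [Finset.sum_ite, Finset.sum_const, Finset.sum_const]
    have h1 : (Finset.univ.filter fun x : F4 => x = 0).card = 1 := by
      rw [Finset.card_eq_one]
      exact ⟨0, by ext; simp⟩
    have h2 := Finset.card_filter_add_card_filter_not (s := (Finset.univ : Finset F4)) (· = 0)
    rw [h1, Finset.card_univ, F4.card] at h2
    have h3 : (Finset.univ.filter fun x : F4 => ¬ x = 0).card = 3 := by omega
    rw [h1, h3, hL, hM, Real.exp_log (by linarith), Real.exp_log (by positivity)]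
    simp only [nsmul_eq_mul]
    push_cast
    ring
  have hsum : ∑ x : Fin n → F4, ∏ i, w (x i) = 1 := by
    rw [← Fintype.prod_sum, hw]
    simp
  have hprod : ∀ x : Fin n → F4, ∏ i, w (x i) = Real.exp (n * L - hammingNorm x * (L - M)) := by
    intro x
    have h1 : ∀ i, w (x i) = Real.exp (L - if x i ≠ 0 then L - M else 0) := by
      intro i
      by_cases h : x i = 0 <;> simp [w, h]
    rw [Finset.prod_congr rfl fun i _ => h1 i, ← Real.exp_sum, Finset.sum_sub_distrib,
      ← Finset.sum_filter, Finset.sum_const, Finset.sum_const, nsmul_eq_mul, nsmul_eq_mul]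
    simp [hammingNorm]
  have hpow : (4 : ℝ) ^ (n * qEntropy 4 p) = Real.exp (-(n * L - n * p * (L - M))) := by
    rw [Real.rpow_def_of_pos (by norm_num)]
    congr 1
    have h4 : Real.log 4 ≠ 0 := (Real.log_pos (by norm_num)).ne'
    have h3 : p / (((4 : ℕ) : ℝ) - 1) = p / 3 := by norm_num
    rw [qEntropy, h3, Real.logb, Real.logb, ← hL, ← hM, Nat.cast_ofNat]
    field_simp
    ring
  rw [hpow, Real.exp_neg, ← one_div, le_div_iff₀ (Real.exp_pos _), ← nsmul_eq_mul]
  calc _ ≤ ∑ x ∈ Finset.univ.filter fun x : Fin n → F4 => (hammingNorm x : ℝ) ≤ n * p,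
        ∏ i, w (x i) := by
        refine Finset.card_nsmul_le_sum _ _ _ fun x hx => ?_
        rw [hprod, Real.exp_le_exp]
        have h := mul_le_mul_of_nonneg_right (Finset.mem_filter.1 hx).2 (sub_nonneg.2 hML)
        linarith
    _ ≤ ∑ x : Fin n → F4, ∏ i, w (x i) := by
        refine Finset.sum_le_univ_sum_of_nonneg fun x => ?_
        rw [hprod]
        exact (Real.exp_pos _).le
    _ = 1 := hsum

end Entropy

/-! ### Inner codes on the Gilbert–Varshamov bound -/

section Inner

open Classical in
/-- Stabilizer codes that meet the quantum Gilbert--Varshamov bound. -/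
lemma exists_innerCode {m n : ℕ} (hm : 1 ≤ m) (hmn : m < n) :
    ∃ C : AddSubgroup (Fin n → F4), IsStabilizerCode C m ∧
      (m : ℝ) / n ≥ 1 - 2 * qEntropy 4 ((minDist C : ℝ) / n) ∧
      entropyInv4 ((1 - (m : ℝ) / n) / 2) ≤ (minDist C : ℝ) / n ∧
      ∃ ρ : (Fin m → F4) ≃+ traceDual C ⧸ C.addSubgroupOf (traceDual C),
        ∀ (a b : Fin m → F4) (u v : traceDual C),
          ρ a = QuotientAddGroup.mk u → ρ b = QuotientAddGroup.mk v →
          traceInner (u : Fin n → F4) (v : Fin n → F4) = traceInner a b := by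
  obtain ⟨l, rfl⟩ := Nat.exists_eq_add_of_lt hmn
  set n := m + l + 1 with hn
  have hn0 : (0 : ℝ) < n := by positivity
  have hmn' : (m : ℝ) < n := by exact_mod_cast hmn
  set y := (1 - (m : ℝ) / n) / 2 with hy
  have hmdiv : (m : ℝ) / n < 1 := (div_lt_one hn0).2 hmn'
  have hmdiv0 : 0 ≤ (m : ℝ) / n := by positivity
  have hy0 : 0 < y := by linarith
  have hy2 : y ≤ 1 / 2 := by linarith
  have hy1 : y ∈ Set.Icc (0 : ℝ) 1 := ⟨hy0.le, by linarith⟩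
  set τ := entropyInv4 y with hτ
  have hτ0 : 0 < τ := entropyInv4_pos hy0 hy1.2
  let S : Finset (Fin n → F4) := Finset.univ.filter fun x => (hammingNorm x : ℝ) ≤ n * τ
  have hS : S.card ≤ 2 ^ (l + 1) := by
    have h := card_ball_le n hτ0 (entropyInv4_mem hy1).2
    rw [qEntropy_entropyInv4 hy1] at h
    -- Thus 4^(ny) = 2^(n-m), where l + 1 = n - m.
    have h1 : (n : ℝ) * y = (2 : ℝ)⁻¹ * ((l + 1 : ℕ) : ℝ) := by
      rw [hy]
      field_simp
      rw [hn]
      push_cast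
      ring
    have h2 : (4 : ℝ) ^ ((2 : ℝ)⁻¹) = 2 := by
      rw [show (4 : ℝ) = 2 ^ (2 : ℝ) by norm_num, ← Real.rpow_mul (by norm_num)]
      norm_num
    rw [h1, Real.rpow_mul (by norm_num), h2, Real.rpow_natCast] at h
    exact_mod_cast h
  have h0S : (0 : Fin n → F4) ∈ S := by
    simp only [S, Finset.mem_filter, Finset.mem_univ, true_and, hammingNorm_zero, Nat.cast_zero]
    positivity
  -- Removing 0 from the ball turns |S| ≤ 2^(n-m) into the strict inequality required.
  obtain ⟨C, hC, hCT, hρ⟩ := exists_stabilizerCode (l := l + 1) (n := n) (by omega) hm (S.erase 0)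
    (Finset.notMem_erase _ _) ((Finset.card_erase_lt_of_mem h0S).trans_le hS)
  have hd : n * τ ≤ minDist C := by
    have h1 : ⌊n * τ⌋₊ + 1 ≤ minDist C := by
      refine hC.le_minDist hm fun u hu hu' => ?_
      have hu0 : u ≠ 0 := fun h => hu' (h ▸ C.zero_mem)
      have h2 := hCT u hu hu0
      rw [Finset.mem_erase, not_and] at h2
      have h3 := h2 hu0
      simp only [S, Finset.mem_filter, Finset.mem_univ, true_and, not_le] at h3
      exact Nat.succ_le_of_lt ((Nat.floor_lt (by positivity)).2 h3)
    have h2 := Nat.lt_floor_add_one (n * τ)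
    have h3 : ((⌊n * τ⌋₊ + 1 : ℕ) : ℝ) ≤ minDist C := by exact_mod_cast h1
    push_cast at h3
    linarith
  have hd' : τ ≤ (minDist C : ℝ) / n := by
    rw [le_div_iff₀ hn0, mul_comm]
    exact hd
  have hd1 : (minDist C : ℝ) / n ≤ 1 := by
    rw [div_le_one hn0]
    have h := hC.minDist_le_card hm
    rw [Fintype.card_fin] at h
    exact_mod_cast h
  refine ⟨C, hC, ?_, hd', hρ⟩
  have := le_qEntropy_of_entropyInv4_le hy0.le hy2 hd' hd1
  linarith

end Inner

end QuantumCode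
namespace QuantumCode

/-! ### Existence of the maximum -/

section Optimum

/-- The maximum in the definition of the bound exists and is positive. -/
lemma exists_isGreatest {R : ℝ} (hR0 : 0 < R) (hR1 : R < 1) :
    ∃ r ∈ Set.Ioo R 1, IsGreatest
      ((fun r : ℝ => 1 / 2 * (1 - R / r) * entropyInv4 ((1 - r) / 2)) '' Set.Ioo R 1)
      (1 / 2 * (1 - R / r) * entropyInv4 ((1 - r) / 2)) ∧
      0 < 1 / 2 * (1 - R / r) * entropyInv4 ((1 - r) / 2) := by
  set f := fun r : ℝ => 1 / 2 * (1 - R / r) * entropyInv4 ((1 - r) / 2) with hf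
  have hcont : ContinuousOn f (Set.Icc R 1) := by
    refine ContinuousOn.mul ?_ ?_
    · refine continuousOn_const.mul (continuousOn_const.sub (continuousOn_const.div continuousOn_id
        fun r hr => (hR0.trans_le hr.1).ne'))
    · refine continuousOn_entropyInv4.comp (by fun_prop) fun r hr => ?_
      constructor <;> linarith [hr.1, hr.2]
  have hpos : ∀ r ∈ Set.Ioo R 1, 0 < f r := by
    intro r hr
    have h1 : R / r < 1 := (div_lt_one (hR0.trans hr.1)).2 hr.1
    exact mul_pos (by linarith) (entropyInv4_pos (by linarith [hr.2]) (by linarith [hr.1]))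
  -- The function is continuous on the closed interval, positive inside and zero at both ends, so
  -- its maximum is interior.
  obtain ⟨r, hr, hmax⟩ := isCompact_Icc.exists_isMaxOn (Set.nonempty_Icc.2 hR1.le) hcont
  have hmid : (R + 1) / 2 ∈ Set.Ioo R 1 := ⟨by linarith, by linarith⟩
  have hrpos : 0 < f r := (hpos _ hmid).trans_le (hmax (Set.Ioo_subset_Icc_self hmid))
  have hr' : r ∈ Set.Ioo R 1 := by
    refine ⟨lt_of_le_of_ne hr.1 fun h => ?_, lt_of_le_of_ne hr.2 fun h => ?_⟩
    · rw [hf, ← h] at hrpos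
      simp [hR0.ne'] at hrpos
    · rw [hf, h] at hrpos
      simp [entropyInv4_zero] at hrpos
  refine ⟨r, hr', ⟨⟨r, hr', rfl⟩, ?_⟩, hrpos⟩
  rintro _ ⟨s, hs, rfl⟩
  exact hmax (Set.Ioo_subset_Icc_self hs)

end Optimum

/-! ### Parameters of Zyablov codes and the asymptotic family -/

namespace ZyablovCode

variable (Q : ZyablovCode)

lemma one_lt_m : 1 < Q.m := by
  have h1 := Q.k_pos.trans Q.k_le
  by_contra! h
  have h2 : Q.m - 1 = 0 := by omega
  rw [h2] at h1
  simp at h1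

lemma two_mul_k_lt : 2 * Q.k < Q.n := by
  have h1 := Q.k_le
  have h2 := Q.one_lt_m
  have h3 : 2 ^ Q.m = 2 * 2 ^ (Q.m - 1) := by
    rw [← pow_succ']
    congr 1
    omega
  have h4 : 0 < 2 ^ (Q.m - 1) := by positivity
  unfold n
  omega

lemma isStabilizerCode_outer : IsStabilizerCode Q.outer (Q.m * (Q.n - 2 * Q.k)) :=
  QuantumCode.isStabilizerCode_outer Q.α_primitive Q.basis_selfDual Q.ω_sq Q.two_mul_k_lt

lemma isStabilizerCode_code : IsStabilizerCode Q.code Q.dim :=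
  isStabilizerCode_concatCode Q.ρ_inner Q.isStabilizerCode_outer Q.inner_isStabilizerCode

lemma dim_pos : 0 < Q.dim := by
  have h1 := Q.one_lt_m
  have h2 := Q.two_mul_k_lt
  exact Nat.mul_pos (by omega) (by omega)

lemma mul_minDist_le_minDist : (Q.k + 1) * minDist Q.C₂ ≤ minDist Q.code := by
  classical
  refine Q.isStabilizerCode_code.le_minDist Q.dim_pos fun u hu hu' => ?_
  refine mul_minDist_le_hammingNorm Q.ρ_inner Q.inner_isStabilizerCode.1 ?_ hu hu'
  intro v hv hv0
  exact lt_card_blocks_outer Q.α_primitive Q.basis_selfDual Q.ω_sq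
    (show Q.k ≤ Q.n by have := Q.two_mul_k_lt; omega) hv hv0

lemma relDist_le_one : Q.relDist ≤ 1 := by
  have h := Q.isStabilizerCode_code.minDist_le_card Q.dim_pos
  rw [Fintype.card_prod, Fintype.card_fin, Fintype.card_fin] at h
  exact div_le_one_of_le₀ (by exact_mod_cast h) (Nat.cast_nonneg _)

lemma mul_le_relDist :
    ((Q.k : ℝ) + 1) / Q.n * ((minDist Q.C₂ : ℝ) / Q.n₂) ≤ Q.relDist := by
  rw [div_mul_div_comm, relDist, length, Nat.cast_mul]
  have h : (((Q.k + 1) * minDist Q.C₂ : ℕ) : ℝ) ≤ minDist Q.code := by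
    exact_mod_cast Q.mul_minDist_le_minDist
  push_cast at h
  gcongr

lemma rate_eq : Q.rate = (1 - 2 * ((Q.k : ℝ) / Q.n)) * ((Q.m : ℝ) / Q.n₂) := by
  have h := Q.two_mul_k_lt
  have hn : (Q.n : ℝ) ≠ 0 := by
    have : 0 < Q.n := by omega
    positivity
  rw [rate, dim, length, Nat.cast_mul, Nat.cast_mul, Nat.cast_sub h.le, Nat.cast_mul]
  field_simp
  push_cast
  ring

end ZyablovCode

/-- Zyablov codes whose inner codes have rate at most, but nearly, `r`, and whose outer codes have
rate nearly `1 - 2 a`. -/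
lemma exists_zyablovCode {r a : ℝ} (hr0 : 0 < r) (hr1 : r < 1) (ha0 : 0 < a) (ha : a < 1 / 2)
    {m : ℕ} (hm : 1 ≤ m) (hk : 1 ≤ ⌊a * ((2 ^ m - 1 : ℕ) : ℝ)⌋₊) :
    ∃ Q : ZyablovCode, Q.m = m ∧ Q.k = ⌊a * ((2 ^ m - 1 : ℕ) : ℝ)⌋₊ ∧
      Q.n₂ = ⌈r⁻¹ * (m : ℝ)⌉₊ ∧ a * entropyInv4 ((1 - r) / 2) ≤ Q.relDist := by
  have hm0 : (0 : ℝ) < m := by exact_mod_cast hm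
  have hceil := Nat.le_ceil (r⁻¹ * (m : ℝ))
  set n₂ := ⌈r⁻¹ * (m : ℝ)⌉₊ with hn₂
  have hmn : m < n₂ := by
    have h1 : (1 : ℝ) < r⁻¹ := (one_lt_inv₀ hr0).2 hr1
    have h2 : (m : ℝ) < n₂ := by nlinarith
    exact_mod_cast h2
  have hn₂0 : (0 : ℝ) < n₂ := by exact_mod_cast (Nat.zero_le m).trans_lt hmn
  -- Rounding n₂ up keeps the inner rate at most r, so monotonicity of H₄⁻¹ gives the inner distance
  -- bound without passing to a limit.
  have hrate : (m : ℝ) / n₂ ≤ r := by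
    rw [div_le_iff₀ hn₂0]
    calc (m : ℝ) = r * (r⁻¹ * m) := by field_simp
      _ ≤ r * n₂ := by gcongr
  obtain ⟨C₂, hC₂, hgv, hdist, ρ, hρ⟩ := exists_innerCode hm hmn
  obtain ⟨α, hα⟩ := exists_primitive_element (m := m) (by omega)
  obtain ⟨b, hb⟩ := exists_selfDual_basis (m := m) (by omega)
  obtain ⟨ω, hω⟩ := F4.exists_omega
  have hkle : ⌊a * ((2 ^ m - 1 : ℕ) : ℝ)⌋₊ ≤ 2 ^ (m - 1) - 1 := by
    have h3 : 2 ^ m = 2 * 2 ^ (m - 1) := by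
      rw [← pow_succ']
      congr 1
      omega
    have h4 : 0 < 2 ^ (m - 1) := by positivity
    have h5 : ⌊a * ((2 ^ m - 1 : ℕ) : ℝ)⌋₊ < 2 ^ (m - 1) := by
      rw [Nat.floor_lt (by positivity), h3]
      have h6 : ((2 * 2 ^ (m - 1) - 1 : ℕ) : ℝ) ≤ 2 * ((2 ^ (m - 1) : ℕ) : ℝ) := by
        exact_mod_cast Nat.sub_le _ _
      have h7 : (0 : ℝ) < ((2 ^ (m - 1) : ℕ) : ℝ) := by exact_mod_cast h4
      nlinarith
    omega
  let Q : ZyablovCode :=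
    { m := m
      k := ⌊a * ((2 ^ m - 1 : ℕ) : ℝ)⌋₊
      k_pos := hk
      k_le := hkle
      α := α
      α_primitive := hα
      basis := b
      basis_selfDual := hb
      ω := ω
      ω_sq := hω
      n₂ := n₂
      C₂ := C₂
      inner_isStabilizerCode := hC₂
      inner_gv := hgv
      ρ := ρ
      ρ_inner := hρ }
  refine ⟨Q, rfl, rfl, rfl, ?_⟩
  refine le_trans ?_ (ZyablovCode.mul_le_relDist _)
  have hmdiv0 : 0 ≤ (m : ℝ) / n₂ := by positivity
  refine mul_le_mul ?_ (le_trans (entropyInv4_mono ?_ ?_ ?_) hdist) ?_ (by positivity)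
  -- The distance factor k + 1 absorbs the floor in k: an < k + 1.
  · change a ≤ ((⌊a * ((2 ^ m - 1 : ℕ) : ℝ)⌋₊ : ℝ) + 1) / ((2 ^ m - 1 : ℕ) : ℝ)
    have h2 : 2 ≤ 2 ^ m := by
      calc 2 = 2 ^ 1 := rfl
        _ ≤ 2 ^ m := Nat.pow_le_pow_right (by norm_num) hm
    have h3 : (0 : ℝ) < ((2 ^ m - 1 : ℕ) : ℝ) := by
      have : 0 < 2 ^ m - 1 := by omega
      exact_mod_cast this
    rw [le_div_iff₀ h3]
    exact (Nat.lt_floor_add_one _).le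
  · constructor <;> linarith
  · constructor <;> linarith
  · linarith
  · exact (entropyInv4_mem ⟨by linarith, by linarith⟩).1

end QuantumCode

theorem theorem3 (R : ℝ) (hR0 : 0 < R) (hR1 : R < 1) :
    ∃ δ : ℝ,
      IsGreatest
        ((fun r : ℝ => 1 / 2 * (1 - R / r) * QuantumCode.entropyInv4 ((1 - r) / 2)) ''
          Set.Ioo R 1) δ ∧
      0 < δ ∧
      ∃ Q : ℕ → QuantumCode.ZyablovCode,
        (∀ i, QuantumCode.IsStabilizerCode (Q i).outer ((Q i).m * ((Q i).n - 2 * (Q i).k))) ∧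
        (∀ i, QuantumCode.IsStabilizerCode (Q i).code (Q i).dim) ∧
        Tendsto (fun i => (Q i).length) atTop atTop ∧
        Tendsto (fun i => (Q i).rate) atTop (𝓝 R) ∧
        δ ≤ liminf (fun i => (Q i).relDist) atTop := by
  obtain ⟨r, ⟨hr0, hr1⟩, hgreatest, hpos⟩ := QuantumCode.exists_isGreatest hR0 hR1
  refine ⟨_, hgreatest, hpos, ?_⟩
  have hr : 0 < r := hR0.trans hr0
  have hRr : R / r < 1 := (div_lt_one hr).2 hr0
  have hRr0 : 0 < R / r := div_pos hR0 hr
  -- The limit of k/n, chosen so that the outer rate tends to 1 - 2a = R/r.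
  set a := 1 / 2 * (1 - R / r) with ha
  have ha0 : 0 < a := by linarith
  have ha1 : a < 1 / 2 := by linarith
  have hlen : Tendsto (fun m : ℕ => ((2 ^ m - 1 : ℕ) : ℝ)) atTop atTop := by
    refine tendsto_natCast_atTop_atTop.comp (tendsto_atTop_mono (f := id) (fun m => ?_) tendsto_id)
    exact Nat.le_sub_one_of_lt Nat.lt_two_pow_self
  -- Beyond m₀ one has an ≥ 1, so that k = ⌊an⌋ is at least 1.
  obtain ⟨m₀, hm₀⟩ := ((hlen.const_mul_atTop ha0).eventually_ge_atTop 1).exists_forall_of_atTop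
  have hex : ∀ i : ℕ, ∃ Q : QuantumCode.ZyablovCode, Q.m = i + (m₀ + 1) ∧
      Q.k = ⌊a * ((2 ^ (i + (m₀ + 1)) - 1 : ℕ) : ℝ)⌋₊ ∧
      Q.n₂ = ⌈r⁻¹ * ((i + (m₀ + 1) : ℕ) : ℝ)⌉₊ ∧
      a * QuantumCode.entropyInv4 ((1 - r) / 2) ≤ Q.relDist := fun i =>
    QuantumCode.exists_zyablovCode hr hr1 ha0 ha1 (by omega)
      (Nat.le_floor (by simpa using hm₀ (i + (m₀ + 1)) (by omega)))
  choose Q hm hk hn₂ hdist using hex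
  have hn : ∀ i, (Q i).n = 2 ^ (i + (m₀ + 1)) - 1 := fun i => by
    rw [QuantumCode.ZyablovCode.n, hm]
  have hshift := tendsto_add_atTop_nat (m₀ + 1)
  refine ⟨Q, fun i => (Q i).isStabilizerCode_outer, fun i => (Q i).isStabilizerCode_code, ?_, ?_,
    ?_⟩
  · refine tendsto_atTop_mono (f := id) (fun i => ?_) tendsto_id
    have h1 : i ≤ (Q i).n := by
      have h := (Nat.lt_two_pow_self (n := i + (m₀ + 1)))
      rw [hn]
      omega
    have h2 : 0 < (Q i).n₂ := by
      rw [hn₂, Nat.ceil_pos]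
      positivity
    exact h1.trans (Nat.le_mul_of_pos_right _ h2)
  · have h1 : Tendsto (fun i => ((Q i).k : ℝ) / (Q i).n) atTop (𝓝 a) := by
      have h := ((tendsto_nat_floor_mul_div_atTop ha0.le).comp hlen).comp hshift
      refine h.congr fun i => ?_
      rw [hk, hn]
      rfl
    have h2 : Tendsto (fun i => ((Q i).m : ℝ) / (Q i).n₂) atTop (𝓝 r) := by
      have h := ((tendsto_nat_ceil_mul_div_atTop (inv_pos.2 hr).le).comp
        (tendsto_natCast_atTop_atTop (R := ℝ))).comp hshift
      have h' := h.inv₀ (inv_pos.2 hr).ne'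
      rw [inv_inv] at h'
      refine h'.congr fun i => ?_
      rw [hm, hn₂]
      simp only [Function.comp_apply, inv_div]
    have h3 := ((h1.const_mul 2).const_sub 1).mul h2
    have h4 : (1 - 2 * a) * r = R := by
      rw [ha]
      field_simp
      ring
    rw [h4] at h3
    exact h3.congr fun i => (Q i).rate_eq.symm
  -- In ℝ the liminf bound also needs the sequence bounded above, here by 1.
  · exact le_liminf_of_le
      (isBoundedUnder_of ⟨1, fun i => (Q i).relDist_le_one⟩ : IsBoundedUnder _ _ _).isCoboundedUnder_ge
      (Eventually.of_forall hdist)
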